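/- Let $b\in\mathbb{R}^m$ and let $C,A_1,\dots,A_m\in\mathbb{S}^n$ be real symmetric matrices. Write $\langle X,Y\rangle=\operatorname{tr}(X^{\mathsf T}Y)$, $\|X\|^2=\langle X,X\rangle$, $\mathcal{A}(X)=(\langle A_1,X\rangle,\dots,\langle A_m,X\rangle)$ and $\mathcal{A}^*(y)=\sum_i y_iA_i$. Consider the semidefinite programs $$\text{(P)}\ \min_X\ \langle C,X\rangle\ \text{ s.t. } \mathcal{A}(X)=b,\ X\succeq 0, \qquad \text{(D)}\ \max_{y,Z}\ b^{\mathsf T}y\ \text{ s.t. } Z+\mathcal{A}^*(y)=C,\ Z\succeq 0,$$ with sets of optimal solutions $\mathcal{P}^\star$ and $\mathcal{D}^\star$. For $\rho>0$ let $F(X)=\langle C,X\rangle+\rho\max\{\lambda_{\max}(-X),0\}$, and let $\mathcal{X}_0=\{X\in\mathbb{S}^n:\mathcal{A}(X)=b\}$. **The $(r_{\mathrm p},r_{\mathrm c})$ spectral bundle method (SBMP).** Let $r_{\mathrm p}\ge0$, $r_{\mathrm c}\ge1$ be integers, $r=r_{\mathrm p}+r_{\mathrm c}$ (necessarily $r\le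 n$), $\alpha>0$, $\beta\in(0,1)$ and $\Omega_0\in\mathbb{S}^n$. For $c>0$, $\bar W\in\mathbb{S}^n$ and $P\in\mathbb{R}^{n\times r}$ put $\mathcal{W}_c(\bar W,P)=\{\gamma\bar W+PSP^{\mathsf T}: \gamma\ge0,\ S\in\mathbb{S}^r_+,\ \gamma+\operatorname{tr}S\le c\}$ and $\hat F_{(\bar W,P)}(X)=\langle C,X\rangle+\rho\max_{W\in\mathcal{W}_1(\bar W,P)}\langle W,-X\rangle$. Start with any $\bar W_0\succeq0$ with $\operatorname{tr}\bar W_0=1$, and with $P_0$ whose columns are the top $r$ orthonormal eigenvectors of $-\Omega_0$. For $t=0,1,2,\dots$: 1. Let $X_{t+1}^\star$ minimize $\hat F_{(\bar W_t,P_t)}(X)+\frac\alpha2\|X-\Omega_t\|^2$ over $X\in\mathcal{X}_0$. Let $W_t^\star=\gamma_t^\star\bar W_t+P_tS_t^\star P_t^{\mathsf T}$ (with $\gamma_t^\star\ge0$, $S_t^\star\succeq0$, $\gamma_t^\star+\operatorname{tr}S_t^\star\le\rho$) and $y_t^\star\in\mathbb{R}^m$ solve the dual form of this problem, i.e. let $(W_t^\star,y_t^\star)$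 minimize $\langle W-C,\Omega_t\rangle-\langle b-\mathcal{A}(\Omega_t),y\rangle+\frac1{2\alpha}\|W-C+\mathcal{A}^*(y)\|^2$ over $W\in\mathcal{W}_\rho(\bar W_t,P_t)$, $y\in\mathbb{R}^m$. 2. If $t=0$ and $\mathcal{A}(\Omega_0)\ne b$, or if $\beta\big(F(\Omega_t)-\hat F_{(\bar W_t,P_t)}(X_{t+1}^\star)\big)\le F(\Omega_t)-F(X_{t+1}^\star)$, set $\Omega_{t+1}=X_{t+1}^\star$; otherwise set $\Omega_{t+1}=\Omega_t$. 3. Take an eigenvalue decomposition $S_t^\star=Q_1\Sigma_1Q_1^{\mathsf T}+Q_2\Sigma_2Q_2^{\mathsf T}$ with $Q_1\in\mathbb{R}^{r\times r_{\mathrm p}}$ the top $r_{\mathrm p}$ and $Q_2\in\mathbb{R}^{r\times r_{\mathrm c}}$ the remaining orthonormal eigenvectors, and let $V_t\in\mathbb{R}^{n\times r_{\mathrm c}}$ consist of top $r_{\mathrm c}$ orthonormal eigenvectors of $-X_{t+1}^\star$. Choose $P_{t+1}\in\mathbb{R}^{n\times r}$ with $P_{t+1}^{\mathsf T}P_{t+1}=I_r$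 whose column space contains the columns of $V_t$ and of $P_tQ_1$, and set $\bar W_{t+1}=\frac{1}{\gamma_t^\star+\operatorname{tr}\Sigma_2}\big(\gamma_t^\star\bar W_t+P_tQ_2\Sigma_2Q_2^{\mathsf T}P_t^{\mathsf T}\big)$ (any $\bar W_{t+1}\succeq0$ with $\operatorname{tr}\bar W_{t+1}=1$ if $\gamma_t^\star+\operatorname{tr}\Sigma_2=0$). **Theorem.** Suppose that $A_1,\dots,A_m$ are linearly independent and that (P) and (D) are both strictly feasible. Let $\beta\in(0,1)$, $\alpha>0$, $r_{\mathrm c}\ge1$, $r_{\mathrm p}\ge0$, $\rho>2\max_{(y^\star,Z^\star)\in\mathcal{D}^\star}\operatorname{tr}(Z^\star)+1$ and $\Omega_0\in\mathbb{S}^n$. Then there is a constant $K$, independent of $\varepsilon$ and of the choices made by the method, such that for every sequence generated by $(r_{\mathrm p},r_{\mathrm c})$-SBMP from $\Omega_0$ and every $\varepsilon>0$ there is an iteration $t\le K\max\{1,1/\varepsilon^3\}$ at which, with $X^\star\in\mathcal{P}^\star$, $$F(\Omega_t)-F(X^\star)\le\varepsilon,\qquad \mathcal{A}(\Omega_t)=b,\quad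 \lambda_{\min}(\Omega_t)\ge-\varepsilon,$$ $$\|W_t^\star+\mathcal{A}^*(y_t^\star)-C\|^2\le\varepsilon,\quad W_t^\star\succeq0,\qquad |\langle C,\Omega_t\rangle-\langle b,y_t^\star\rangle|\le\sqrt{\varepsilon}.$$ If moreover strict complementarity holds, i.e. $\operatorname{rank}X^\star+\operatorname{rank}Z^\star=n$ for some $X^\star\in\mathcal{P}^\star$ and $(y^\star,Z^\star)\in\mathcal{D}^\star$, then, with another such constant $K$, these conditions hold at some iteration $t\le K\max\{1,1/\varepsilon\}$. -/

import Mathlib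

namespace SBMP

open scoped Matrix

/-- Data of a pair of primal and dual semidefinite programs in standard form,
`min ⟨C, X⟩ s.t. ⟨Aᵢ, X⟩ = bᵢ, X ⪰ 0` and `max bᵀy s.t. Z + ∑ᵢ yᵢ Aᵢ = C, Z ⪰ 0`,
with symmetric `n × n` matrices `A₁, …, Aₘ, C`. -/
structure SDP (n m : ℕ) where
  A : Fin m → Matrix (Fin n) (Fin n) ℝ
  b : Fin m → ℝ
  C : Matrix (Fin n) (Fin n) ℝ
  symm_A : ∀ i, (A i).IsSymm
  symm_C : C.IsSymm

/-- The trace inner product `⟨X, Y⟩ = tr(XᵀY)`. -/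
def frobInner {n : ℕ} (X Y : Matrix (Fin n) (Fin n) ℝ) : ℝ := (Xᵀ * Y).trace

/-- The squared Frobenius norm `‖X‖²`. -/
def frobSq {n : ℕ} (X : Matrix (Fin n) (Fin n) ℝ) : ℝ := frobInner X X

/-- Largest eigenvalue of a symmetric matrix. -/
noncomputable def lamMax {n : ℕ} (M : Matrix (Fin n) (Fin n) ℝ) : ℝ := sSup (spectrum ℝ M)

/-- Smallest eigenvalue of a symmetric matrix. -/
noncomputable def lamMin {n : ℕ} (M : Matrix (Fin n) (Fin n) ℝ) : ℝ := sInf (spectrum ℝ M)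

/-- `M = Q diag(d) Qᵀ` with `Q` orthogonal and the eigenvalues `d` in decreasing order. -/
def IsEigDecomp {k : ℕ} (M Q : Matrix (Fin k) (Fin k) ℝ) (d : Fin k → ℝ) : Prop :=
  Qᵀ * Q = 1 ∧ Antitone d ∧ M = Q * Matrix.diagonal d * Qᵀ

/-- The columns of `V` are top `k` orthonormal eigenvectors of the symmetric matrix `M`: they are
the first `k` columns in some eigenvalue decomposition of `M` with decreasing eigenvalues. -/
def IsTopEigenvectors {n k : ℕ} (M : Matrix (Fin n) (Fin n) ℝ)
    (V : Matrix (Fin n) (Fin k) ℝ) : Prop :=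
  ∃ (h : k ≤ n) (Q : Matrix (Fin n) (Fin n) ℝ) (d : Fin n → ℝ),
    IsEigDecomp M Q d ∧ V = Q.submatrix id (Fin.castLE h)

namespace SDP

variable {n m : ℕ} (D : SDP n m)

/-- `𝒜(X) = (⟨A₁, X⟩, …, ⟨Aₘ, X⟩)`. -/
def Amap (X : Matrix (Fin n) (Fin n) ℝ) : Fin m → ℝ := fun i => frobInner (D.A i) X

/-- `𝒜*(y) = ∑ᵢ yᵢ Aᵢ`. -/
def Aadj (y : Fin m → ℝ) : Matrix (Fin n) (Fin n) ℝ := ∑ i, y i • D.A i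

/-- The affine set `{X symmetric : 𝒜(X) = b}`. -/
def affineSet : Set (Matrix (Fin n) (Fin n) ℝ) := {X | X.IsSymm ∧ D.Amap X = D.b}

def primalFeasible : Set (Matrix (Fin n) (Fin n) ℝ) := {X | X.PosSemidef ∧ D.Amap X = D.b}

def dualFeasible : Set ((Fin m → ℝ) × Matrix (Fin n) (Fin n) ℝ) :=
  {p | p.2 + D.Aadj p.1 = D.C ∧ p.2.PosSemidef}

/-- Primal optimal solutions. -/
def primalOptimal : Set (Matrix (Fin n) (Fin n) ℝ) :=
  {X | X ∈ D.primalFeasible ∧ ∀ X' ∈ D.primalFeasible, frobInner D.C X ≤ frobInner D.C X'}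

/-- Dual optimal solutions `(y, Z)`. -/
def dualOptimal : Set ((Fin m → ℝ) × Matrix (Fin n) (Fin n) ℝ) :=
  {p | p ∈ D.dualFeasible ∧ ∀ p' ∈ D.dualFeasible, D.b ⬝ᵥ p'.1 ≤ D.b ⬝ᵥ p.1}

/-- Both programs are strictly feasible. -/
def Slater : Prop :=
  (∃ X : Matrix (Fin n) (Fin n) ℝ, X.PosDef ∧ D.Amap X = D.b) ∧
  (∃ (y : Fin m → ℝ) (Z : Matrix (Fin n) (Fin n) ℝ), Z.PosDef ∧ Z + D.Aadj y = D.C)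

/-- Some primal optimal `X` and dual optimal `(y, Z)` satisfy `rank X + rank Z = n`. -/
def StrictComplementarity : Prop :=
  ∃ X ∈ D.primalOptimal, ∃ p ∈ D.dualOptimal, X.rank + p.2.rank = n

/-- The maximum of `tr Z` over the dual optimal solutions (under linear independence of the `Aᵢ`
and strict feasibility the dual optimal set is nonempty and compact, so this is a maximum). -/
noncomputable def maxDualTrace : ℝ :=
  sSup ((fun p : (Fin m → ℝ) × Matrix (Fin n) (Fin n) ℝ => p.2.trace) '' D.dualOptimal)

/-- The penalized cost `F(X) = ⟨C, X⟩ + ρ max{λ_max(-X), 0}`. -/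
noncomputable def F (ρ : ℝ) (X : Matrix (Fin n) (Fin n) ℝ) : ℝ :=
  frobInner D.C X + ρ * max (lamMax (-X)) 0

end SDP

/-- `{γ W̄ + P S Pᵀ : γ ≥ 0, S ⪰ 0, γ + tr S ≤ c}`. -/
def weightSet {n r : ℕ} (c : ℝ) (Wbar : Matrix (Fin n) (Fin n) ℝ)
    (P : Matrix (Fin n) (Fin r) ℝ) : Set (Matrix (Fin n) (Fin n) ℝ) :=
  {W | ∃ (γ : ℝ) (S : Matrix (Fin r) (Fin r) ℝ),
    0 ≤ γ ∧ S.PosSemidef ∧ γ + S.trace ≤ c ∧ W = γ • Wbar + P * S * Pᵀ}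

/-- The lower approximation model
`⟨C, X⟩ + ρ max {⟨γ W̄ + P S Pᵀ, -X⟩ : γ ≥ 0, S ⪰ 0, γ + tr S ≤ 1}`. -/
noncomputable def SDP.model {n m r : ℕ} (D : SDP n m) (ρ : ℝ) (Wbar : Matrix (Fin n) (Fin n) ℝ)
    (P : Matrix (Fin n) (Fin r) ℝ) (X : Matrix (Fin n) (Fin n) ℝ) : ℝ :=
  frobInner D.C X + ρ * sSup ((fun W => frobInner W (-X)) '' weightSet 1 Wbar P)

/-- Objective of the regularized master problem with proximal centre `Ω`. -/
noncomputable def SDP.masterObj {n m r : ℕ} (D : SDP n m) (ρ α : ℝ)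
    (Wbar : Matrix (Fin n) (Fin n) ℝ) (P : Matrix (Fin n) (Fin r) ℝ)
    (Ω X : Matrix (Fin n) (Fin n) ℝ) : ℝ :=
  D.model ρ Wbar P X + α / 2 * frobSq (X - Ω)

/-- Objective of the dual form of the master problem, in the variables `(W, y)`:
`⟨W - C, Ω⟩ - ⟨b - 𝒜(Ω), y⟩ + ‖W - C + 𝒜*(y)‖² / (2α)`. -/
noncomputable def SDP.masterDualObj {n m : ℕ} (D : SDP n m) (α : ℝ)
    (Ω : Matrix (Fin n) (Fin n) ℝ) (p : Matrix (Fin n) (Fin n) ℝ × (Fin m → ℝ)) : ℝ :=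
  frobInner (p.1 - D.C) Ω - (D.b - D.Amap Ω) ⬝ᵥ p.2
    + 1 / (2 * α) * frobSq (p.1 - D.C + D.Aadj p.2)

/-- The sequences generated by the method, with `r = rp + rc`. Here `X t` is the solution of the
master problem of iteration `t` (usually denoted `X_{t+1}^⋆`), and `γ t`, `S t`, `y t` are its
multipliers. -/
structure Iterates (n m rp rc : ℕ) where
  Ω : ℕ → Matrix (Fin n) (Fin n) ℝ
  Wbar : ℕ → Matrix (Fin n) (Fin n) ℝ
  P : ℕ → Matrix (Fin n) (Fin (rp + rc)) ℝ
  X : ℕ → Matrix (Fin n) (Fin n) ℝ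
  γ : ℕ → ℝ
  S : ℕ → Matrix (Fin (rp + rc)) (Fin (rp + rc)) ℝ
  y : ℕ → Fin m → ℝ

/-- `W_t^⋆ = γ_t^⋆ W̄_t + P_t S_t^⋆ P_tᵀ`. -/
def Iterates.W {n m rp rc : ℕ} (s : Iterates n m rp rc) (t : ℕ) : Matrix (Fin n) (Fin n) ℝ :=
  s.γ t • s.Wbar t + s.P t * s.S t * (s.P t)ᵀ

/-- The update of the lower model at the end of an iteration. `Q`, `d` is an eigenvalue
decomposition of `S` with decreasing eigenvalues; `Q₁` consists of the first `rp` columns of `Q`,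
`Q₂` of the remaining `rc` ones, and `Σ₂` is the diagonal matrix of the remaining eigenvalues.
`P'` has orthonormal columns, whose span contains those of `V` (top `rc` eigenvectors of `-X`)
and of `P Q₁`. If the normalizing factor `γ + tr Σ₂` vanishes, there is no remaining past
information to aggregate, and `Wbar'` may be any admissible weight. -/
def ModelUpdate {n rp rc : ℕ} (X Wbar : Matrix (Fin n) (Fin n) ℝ)
    (P : Matrix (Fin n) (Fin (rp + rc)) ℝ) (γ : ℝ)
    (S : Matrix (Fin (rp + rc)) (Fin (rp + rc)) ℝ)
    (Wbar' : Matrix (Fin n) (Fin n) ℝ) (P' : Matrix (Fin n) (Fin (rp + rc)) ℝ) : Prop :=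
  ∃ (V : Matrix (Fin n) (Fin rc) ℝ) (Q : Matrix (Fin (rp + rc)) (Fin (rp + rc)) ℝ)
    (d : Fin (rp + rc) → ℝ),
    IsTopEigenvectors (-X) V ∧ IsEigDecomp S Q d ∧
    (let Q₁ : Matrix (Fin (rp + rc)) (Fin rp) ℝ := Q.submatrix id (Fin.castAdd rc)
     let Q₂ : Matrix (Fin (rp + rc)) (Fin rc) ℝ := Q.submatrix id (Fin.natAdd rp)
     let Sig₂ : Matrix (Fin rc) (Fin rc) ℝ := Matrix.diagonal (fun i => d (Fin.natAdd rp i))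
     P'ᵀ * P' = 1 ∧ (∃ B, V = P' * B) ∧ (∃ B, P * Q₁ = P' * B) ∧
     (γ + Sig₂.trace ≠ 0 →
        Wbar' = (γ + Sig₂.trace)⁻¹ • (γ • Wbar + P * Q₂ * Sig₂ * Q₂ᵀ * Pᵀ)) ∧
     (γ + Sig₂.trace = 0 → Wbar'.PosSemidef ∧ Wbar'.trace = 1))

/-- Iteration `t` replaces the reference point by the candidate `X t`: either it is the first
iteration and the initial point violates the affine constraint, or the sufficient descent test
holds. -/
def SDP.Accepts {n m rp rc : ℕ} (D : SDP n m) (ρ β : ℝ) (s : Iterates n m rp rc) (t : ℕ) : Prop :=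
  (t = 0 ∧ D.Amap (s.Ω 0) ≠ D.b) ∨
  β * (D.F ρ (s.Ω t) - D.model ρ (s.Wbar t) (s.P t) (s.X t)) ≤ D.F ρ (s.Ω t) - D.F ρ (s.X t)

/-- `s` is a run (without termination) of the `(rp, rc)` spectral bundle method for primal SDPs,
with penalty `ρ`, proximal parameter `α`, descent parameter `β` and initial point `Ω₀`. -/
structure IsRun {n m rp rc : ℕ} (D : SDP n m) (ρ α β : ℝ) (Ω₀ : Matrix (Fin n) (Fin n) ℝ)
    (s : Iterates n m rp rc) : Prop where
  init_Ω : s.Ω 0 = Ω₀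
  init_P : IsTopEigenvectors (-Ω₀) (s.P 0)
  init_Wbar : (s.Wbar 0).PosSemidef ∧ (s.Wbar 0).trace = 1
  /-- `X t` solves the master problem. -/
  X_mem : ∀ t, s.X t ∈ D.affineSet
  X_min : ∀ t, IsMinOn (D.masterObj ρ α (s.Wbar t) (s.P t) (s.Ω t)) D.affineSet (s.X t)
  /-- `(γ t, S t)` is admissible and `(W t, y t)` solves the dual form of the master problem. -/
  γ_nonneg : ∀ t, 0 ≤ s.γ t
  S_psd : ∀ t, (s.S t).PosSemidef
  γS_le : ∀ t, s.γ t + (s.S t).trace ≤ ρ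
  Wy_min : ∀ t, IsMinOn (D.masterDualObj α (s.Ω t))
    (weightSet ρ (s.Wbar t) (s.P t) ×ˢ Set.univ) (s.W t, s.y t)
  /-- Update of the reference point. -/
  step_accept : ∀ t, D.Accepts ρ β s t → s.Ω (t + 1) = s.X t
  step_null : ∀ t, ¬ D.Accepts ρ β s t → s.Ω (t + 1) = s.Ω t
  /-- Update of the lower model. -/
  step_model : ∀ t, ModelUpdate (s.X t) (s.Wbar t) (s.P t) (s.γ t) (s.S t)
    (s.Wbar (t + 1)) (s.P (t + 1))

/-- The accuracy reached by a primal iterate `Ω` and a dual iterate `(W, y)`: cost gap,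
approximate primal feasibility, approximate dual feasibility, approximate primal-dual
optimality. The value of `F` is the same at all primal optimal solutions. -/
def SDP.IsApproxSolution {n m : ℕ} (D : SDP n m) (ρ ε : ℝ) (Ω W : Matrix (Fin n) (Fin n) ℝ)
    (y : Fin m → ℝ) : Prop :=
  (∃ Xstar ∈ D.primalOptimal, D.F ρ Ω - D.F ρ Xstar ≤ ε) ∧
  (D.Amap Ω = D.b ∧ -ε ≤ lamMin Ω) ∧
  (frobSq (W + D.Aadj y - D.C) ≤ ε ∧ W.PosSemidef) ∧
  |frobInner D.C Ω - D.b ⬝ᵥ y| ≤ Real.sqrt ε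

end SBMP

/-!
The spectral bundle method is analysed through two quantities attached to iteration `t`: the cost
gap `δ = F(Ω_t) - p`, where `p` is the common optimal value of both programs, and the predicted
decrease `v = F(Ω_t) - min (F̂_t + α/2 ‖· - Ω_t‖²)` (`Iterates.predicted`).

*Duality.* Strict feasibility gives attainment and a zero gap (`SDP.exists_optimal_pair`). Since `ρ`
exceeds the trace of a dual solution, the penalty is exact: on the affine set `δ` is nonnegative and
bounds the primal infeasibility, and `F` has bounded sublevel sets.

*One iteration.* Optimality in the dual form of the master problem says that the linear function
`⟨C - W_t, ·⟩` minorizes the model, touches it at the candidate `X_t`, and that `X_t` minimizes this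
function plus the proximal term (`masterSolution`). Hence `v ≥ α/2 ‖X_t - Ω_t‖²`, and small `δ` and
`v` give an approximate primal-dual solution (`MasterSolution.isApproxSolution`). A descent step
decreases `δ` by at least `β v`. After a null step the new model contains both the aggregate weight
`W_t` and an exact weight of `F` at `X_t` (`ModelUpdate.spec`), which forces `v` to decrease by a
multiple of `v²` (`IsRun.null_step`).

*Counting.* Looking along the segment from `Ω_t` to an optimal solution shows `v ≥ w δ` whenever
`δ > η`, with `w` of order `η` in general. A potential of the form `1 / (c v) + B / δ` then
increases by at least one per iteration, and `O(1 / (η w²))` iterations make `δ` and `v` of order `η`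
(`exists_iteration_le`). This is the bound `O(1 / ε³)`.

*Strict complementarity.* If `X̂ + Ẑ` is positive definite, a point of the affine set with cost gap
`δ` lies within `O(√δ)` of the face `{Y : Ẑ Y = 0}`, hence, by a linear error bound, of its
intersection with the affine set; a small move towards `X̂` makes it optimal. So `F` grows
quadratically away from the optimal set (`SDP.exists_quadratic_growth`), `w` may be taken constant,
and the bound improves to `O(1 / ε)`.
-/

namespace SBMP

open scoped Matrix Matrix.Norms.Frobenius

/-! ### The trace inner product and the Frobenius norm -/

section FrobInner

variable {n : ℕ} (X Y Z : Matrix (Fin n) (Fin n) ℝ) (c : ℝ)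

lemma frobInner_add_left : frobInner (X + Y) Z = frobInner X Z + frobInner Y Z := by
  simp [frobInner, Matrix.add_mul]

lemma frobInner_add_right : frobInner X (Y + Z) = frobInner X Y + frobInner X Z := by
  simp [frobInner, Matrix.mul_add]

lemma frobInner_sub_left : frobInner (X - Y) Z = frobInner X Z - frobInner Y Z := by
  simp [frobInner, Matrix.sub_mul]

lemma frobInner_sub_right : frobInner X (Y - Z) = frobInner X Y - frobInner X Z := by
  simp [frobInner, Matrix.mul_sub]

lemma frobInner_smul_left : frobInner (c • X) Y = c * frobInner X Y := by
  simp [frobInner]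

lemma frobInner_smul_right : frobInner X (c • Y) = c * frobInner X Y := by
  simp [frobInner]

lemma frobInner_neg_right : frobInner X (-Y) = -frobInner X Y := by
  simp [frobInner]

lemma frobInner_zero_right : frobInner X 0 = 0 := by simp [frobInner]

lemma frobInner_zero_left : frobInner 0 X = 0 := by simp [frobInner]

lemma frobInner_comm : frobInner X Y = frobInner Y X := by
  unfold frobInner
  rw [← Matrix.trace_transpose, Matrix.transpose_mul, Matrix.transpose_transpose]

lemma frobInner_one_left : frobInner 1 X = X.trace := by simp [frobInner]

lemma frobInner_one_right : frobInner X 1 = X.trace := by simp [frobInner]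

lemma frobSq_nonneg : 0 ≤ frobSq X := by
  simpa [frobSq, frobInner] using (Matrix.posSemidef_conjTranspose_mul_self X).trace_nonneg

lemma norm_sq_eq_frobSq : ‖X‖ ^ 2 = frobSq X := by
  rw [Matrix.frobenius_norm_def, ← Real.sqrt_eq_rpow, Real.sq_sqrt (by positivity)]
  simp only [frobSq, frobInner, Matrix.trace, Matrix.diag, Matrix.mul_apply,
    Matrix.transpose_apply, Real.norm_eq_abs]
  rw [Finset.sum_comm]
  refine Finset.sum_congr rfl fun i _ => Finset.sum_congr rfl fun j _ => ?_
  rw [Real.rpow_two, sq_abs, sq]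

/-- Cauchy–Schwarz for the trace inner product. -/
lemma abs_frobInner_le : |frobInner X Y| ≤ ‖X‖ * ‖Y‖ := by
  refine abs_le_of_sq_le_sq ?_ (by positivity)
  rw [mul_pow, norm_sq_eq_frobSq, norm_sq_eq_frobSq]
  have key : ∀ t : ℝ, 0 ≤ frobSq Y * (t * t) + 2 * frobInner X Y * t + frobSq X := fun t => by
    have h := frobSq_nonneg (X + t • Y)
    simp only [frobSq, frobInner_add_left, frobInner_add_right, frobInner_smul_left,
      frobInner_smul_right, frobInner_comm Y X] at h ⊢
    linarith
  have := discrim_le_zero key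
  unfold discrim at this
  nlinarith

lemma frobInner_mulVec_self (x : Fin n → ℝ) :
    frobInner (Matrix.vecMulVec x x) X = x ⬝ᵥ X *ᵥ x := by
  rw [frobInner, Matrix.transpose_vecMulVec, Matrix.vecMulVec_mul, Matrix.trace_vecMulVec,
    Matrix.dotProduct_mulVec, dotProduct_comm]

lemma frobInner_transpose : frobInner Xᵀ Y = frobInner X Yᵀ := by
  rw [frobInner, frobInner, Matrix.transpose_transpose, ← Matrix.trace_transpose,
    Matrix.transpose_mul, Matrix.trace_mul_comm]

end FrobInner

/-! ### Positive semidefinite matrices -/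

section PSD

variable {n : ℕ} {X Y M : Matrix (Fin n) (Fin n) ℝ}

lemma isHermitian_iff_isSymm : M.IsHermitian ↔ M.IsSymm := by
  rw [Matrix.IsHermitian, Matrix.IsSymm, Matrix.conjTranspose_eq_transpose_of_trivial]

lemma _root_.Matrix.PosSemidef.isSymm' (h : M.PosSemidef) : M.IsSymm :=
  isHermitian_iff_isSymm.1 h.1

open scoped MatrixOrder in
lemma exists_isSymm_mul_self (h : M.PosSemidef) :
    ∃ R : Matrix (Fin n) (Fin n) ℝ, R.IsSymm ∧ M = R * R :=
  ⟨CFC.sqrt M, (Matrix.nonneg_iff_posSemidef.1 (CFC.sqrt_nonneg M)).isSymm',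
    (CFC.sqrt_mul_sqrt_self M h.nonneg).symm⟩

lemma frobInner_nonneg (hX : X.PosSemidef) (hY : Y.PosSemidef) : 0 ≤ frobInner X Y := by
  obtain ⟨R, hR, rfl⟩ := exists_isSymm_mul_self hX
  have := (hY.mul_mul_conjTranspose_same R).trace_nonneg
  rw [Matrix.conjTranspose_eq_transpose_of_trivial, hR.eq] at this
  rw [frobInner, Matrix.transpose_mul, hR.eq]
  rwa [Matrix.mul_assoc, Matrix.trace_mul_comm]

lemma norm_sq_eq_trace_mul_self (hX : X.IsSymm) : ‖X‖ ^ 2 = (X * X).trace := by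
  rw [norm_sq_eq_frobSq, frobSq, frobInner, hX.eq]

lemma norm_le_trace (hX : X.PosSemidef) : ‖X‖ ≤ X.trace := by
  obtain ⟨R, hR, rfl⟩ := exists_isSymm_mul_self hX
  rw [← norm_sq_eq_trace_mul_self hR, sq]
  exact Matrix.frobenius_norm_mul R R

lemma _root_.Matrix.IsSymm.smul_one_sub (hM : M.IsSymm) (c : ℝ) :
    (c • (1 : Matrix (Fin n) (Fin n) ℝ) - M).IsSymm :=
  (Matrix.isSymm_one.smul c).sub hM

lemma posSemidef_iff_quadForm (hM : M.IsSymm) :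
    M.PosSemidef ↔ ∀ x : Fin n → ℝ, 0 ≤ x ⬝ᵥ M *ᵥ x := by
  simp [Matrix.posSemidef_iff_dotProduct_mulVec, hM]

/-- A symmetric matrix is `⪯ c I` as soon as its spectrum lies below `c`. -/
lemma posSemidef_smul_one_sub (hM : M.IsSymm) {c : ℝ} (hc : ∀ a ∈ spectrum ℝ M, a ≤ c) :
    (c • (1 : Matrix (Fin n) (Fin n) ℝ) - M).PosSemidef := by
  rw [Matrix.posSemidef_iff_isHermitian_and_spectrum_nonneg]
  refine ⟨isHermitian_iff_isSymm.2 (hM.smul_one_sub c), ?_⟩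
  have : c • (1 : Matrix (Fin n) (Fin n) ℝ) = algebraMap ℝ _ c := by
    rw [Algebra.algebraMap_eq_smul_one]
  rw [this, ← spectrum.singleton_sub_eq]
  rintro a ha
  obtain ⟨b, rfl, d, hd, rfl⟩ := Set.mem_sub.1 ha
  simpa using hc d hd

lemma bddAbove_spectrum (hM : M.IsSymm) : BddAbove (spectrum ℝ M) := by
  rw [(isHermitian_iff_isSymm.2 hM).spectrum_real_eq_range_eigenvalues]
  exact (Set.finite_range _).bddAbove

lemma posSemidef_lamMax_sub (hM : M.IsSymm) :
    (lamMax M • (1 : Matrix (Fin n) (Fin n) ℝ) - M).PosSemidef :=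
  posSemidef_smul_one_sub hM fun _ ha => le_csSup (bddAbove_spectrum hM) ha

lemma lamMin_eq_neg_lamMax_neg : lamMin M = -lamMax (-M) := by
  rw [lamMin, lamMax, Real.sInf_def, spectrum.neg_eq]

lemma lamMax_neg_nonpos (hM : M.PosSemidef) : lamMax (-M) ≤ 0 := by
  refine Real.sSup_nonpos fun a ha => ?_
  rw [← spectrum.neg_eq] at ha
  have := (Matrix.posSemidef_iff_isHermitian_and_spectrum_nonneg.1 hM).2 ha
  simpa using this

/-- A positive definite matrix dominates a positive multiple of the identity. -/
lemma exists_posSemidef_sub_smul_one (hM : M.PosDef) :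
    ∃ τ : ℝ, 0 < τ ∧ (M - τ • (1 : Matrix (Fin n) (Fin n) ℝ)).PosSemidef := by
  have hpos : ∃ τ : ℝ, 0 < τ ∧ ∀ i, τ ≤ hM.1.eigenvalues i := by
    rcases isEmpty_or_nonempty (Fin n) with h | h
    · exact ⟨1, one_pos, fun i => h.elim i⟩
    · obtain ⟨i, hi⟩ := Finite.exists_min hM.1.eigenvalues
      exact ⟨_, hM.eigenvalues_pos i, hi⟩
  obtain ⟨τ, hτ, h⟩ := hpos
  refine ⟨τ, hτ, ?_⟩
  have := posSemidef_smul_one_sub (M := -M) (c := -τ) hM.posSemidef.isSymm'.neg fun a ha => by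
    rw [← spectrum.neg_eq, Set.mem_neg, hM.1.spectrum_real_eq_range_eigenvalues] at ha
    obtain ⟨i, hi⟩ := ha
    linarith [h i]
  convert this using 1
  rw [neg_smul]
  abel

/-- If `W ⪰ 0` and `tr W ≤ c`, then `⟨W, M⟩` is at most `c` times the positive part of the
largest eigenvalue of `M`. -/
lemma frobInner_le_mul_lamMax (hX : X.PosSemidef) (hM : M.IsSymm) {c : ℝ} (hc : X.trace ≤ c) :
    frobInner X M ≤ c * max (lamMax M) 0 := by
  have h1 := frobInner_nonneg hX (posSemidef_lamMax_sub hM)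
  rw [frobInner_sub_right, frobInner_smul_right, frobInner_one_right] at h1
  have h2 := hX.trace_nonneg
  nlinarith [le_max_left (lamMax M) 0, le_max_right (lamMax M) 0]

/-- Adding `max (λ_max (-X)) 0` to the diagonal makes `X` positive semidefinite. -/
lemma posSemidef_add_smul_one (hX : X.IsSymm) :
    (X + max (lamMax (-X)) 0 • (1 : Matrix (Fin n) (Fin n) ℝ)).PosSemidef := by
  have h1 := posSemidef_lamMax_sub hX.neg
  have h2 : ((max (lamMax (-X)) 0 - lamMax (-X)) • (1 : Matrix (Fin n) (Fin n) ℝ)).PosSemidef :=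
    Matrix.PosSemidef.one.smul (by linarith [le_max_left (lamMax (-X)) 0])
  convert h1.add h2 using 1
  rw [sub_smul]
  abel

end PSD

/-! ### Eigenvalue decompositions -/

section Eig

variable {k : ℕ} {M Q : Matrix (Fin k) (Fin k) ℝ} {d : Fin k → ℝ}

lemma IsEigDecomp.transpose_mul_mul (h : IsEigDecomp M Q d) : Qᵀ * M * Q = Matrix.diagonal d := by
  obtain ⟨h1, -, rfl⟩ := h
  calc Qᵀ * (Q * Matrix.diagonal d * Qᵀ) * Q
      = (Qᵀ * Q) * Matrix.diagonal d * (Qᵀ * Q) := by simp only [Matrix.mul_assoc]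
    _ = _ := by simp [h1]

lemma IsEigDecomp.nonneg (h : IsEigDecomp M Q d) (hM : M.PosSemidef) (i : Fin k) : 0 ≤ d i := by
  have := hM.conjTranspose_mul_mul_same Q
  rw [Matrix.conjTranspose_eq_transpose_of_trivial, h.transpose_mul_mul,
    Matrix.posSemidef_diagonal_iff] at this
  exact this i

lemma IsEigDecomp.spectrum_eq (h : IsEigDecomp M Q d) : spectrum ℝ M = Set.range d := by
  obtain ⟨h1, -, rfl⟩ := h
  have h2 : Q * Qᵀ = 1 := mul_eq_one_comm.1 h1
  let u : (Matrix (Fin k) (Fin k) ℝ)ˣ := ⟨Q, Qᵀ, h2, h1⟩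
  have := spectrum.units_conjugate (R := ℝ) (a := Matrix.diagonal d) (u := u)
  rw [spectrum_diagonal] at this
  exact this

lemma IsEigDecomp.lamMax_eq (h : IsEigDecomp M Q d) (hk : 0 < k) : lamMax M = d ⟨0, hk⟩ := by
  rw [lamMax, h.spectrum_eq]
  refine IsGreatest.csSup_eq ⟨⟨_, rfl⟩, ?_⟩
  rintro _ ⟨i, rfl⟩
  exact h.2.1 (Fin.mk_le_of_le_val (Nat.zero_le _))

lemma transpose_mul_submatrix {n k l : ℕ} {V : Matrix (Fin n) (Fin k) ℝ} (hV : Vᵀ * V = 1)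
    {f : Fin l → Fin k} (hf : Function.Injective f) :
    (V.submatrix id f)ᵀ * V.submatrix id f = 1 := by
  have : (V.submatrix id f)ᵀ * V.submatrix id f = (Vᵀ * V).submatrix f f := by
    ext i j
    simp [Matrix.mul_apply]
  rw [this, hV, Matrix.submatrix_one _ hf]

lemma IsTopEigenvectors.transpose_mul_self {n k : ℕ} {M : Matrix (Fin n) (Fin n) ℝ}
    {V : Matrix (Fin n) (Fin k) ℝ} (h : IsTopEigenvectors M V) : Vᵀ * V = 1 := by
  obtain ⟨hk, Q, d, hQ, rfl⟩ := h
  exact transpose_mul_submatrix hQ.1 (Fin.castLE_injective hk)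

/-- The first of the top eigenvectors attains the largest eigenvalue. -/
lemma IsTopEigenvectors.exists_col {n k : ℕ} {M : Matrix (Fin n) (Fin n) ℝ}
    {V : Matrix (Fin n) (Fin k) ℝ} (h : IsTopEigenvectors M V) (hk : 0 < k) :
    ∃ v : Fin n → ℝ, (∃ e : Fin k → ℝ, v = V *ᵥ e) ∧ v ⬝ᵥ v = 1 ∧ v ⬝ᵥ M *ᵥ v = lamMax M := by
  obtain ⟨hkn, Q, d, hQ, rfl⟩ := h
  have hn : 0 < n := hk.trans_le hkn
  have hcol : (fun i => Q i ⟨0, hn⟩) = Q *ᵥ Pi.single ⟨0, hn⟩ 1 := by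
    ext i; simp
  refine ⟨fun i => Q i ⟨0, hn⟩, ⟨Pi.single ⟨0, hk⟩ 1, ?_⟩, ?_, ?_⟩
  · ext i; simp [Fin.castLE]
  · have := congrFun (congrFun hQ.1 ⟨0, hn⟩) ⟨0, hn⟩
    simpa [Matrix.mul_apply, dotProduct] using this
  · have := congrFun (congrFun hQ.transpose_mul_mul ⟨0, hn⟩) ⟨0, hn⟩
    rw [hQ.lamMax_eq hn, ← Matrix.diagonal_apply_eq d, ← this, hcol, Matrix.mulVec_mulVec,
      Matrix.dotProduct_mulVec, Matrix.vecMul_mulVec, ← Matrix.mul_assoc]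
    simp

end Eig

/-! ### Duality of the two semidefinite programs -/

namespace SDP

variable {n m : ℕ} (D : SDP n m)

lemma Amap_add (X Y : Matrix (Fin n) (Fin n) ℝ) : D.Amap (X + Y) = D.Amap X + D.Amap Y :=
  funext fun _ => frobInner_add_right _ _ _

lemma Amap_sub (X Y : Matrix (Fin n) (Fin n) ℝ) : D.Amap (X - Y) = D.Amap X - D.Amap Y :=
  funext fun _ => frobInner_sub_right _ _ _

lemma Amap_smul (c : ℝ) (X : Matrix (Fin n) (Fin n) ℝ) : D.Amap (c • X) = c • D.Amap X :=
  funext fun _ => frobInner_smul_right _ _ _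

lemma Amap_transpose (X : Matrix (Fin n) (Fin n) ℝ) : D.Amap Xᵀ = D.Amap X := by
  ext i
  rw [Amap, Amap, ← frobInner_transpose, (D.symm_A i).eq]

/-- `𝒜` as a linear map. -/
def AmapLin : Matrix (Fin n) (Fin n) ℝ →ₗ[ℝ] (Fin m → ℝ) where
  toFun := D.Amap
  map_add' := D.Amap_add
  map_smul' := D.Amap_smul

lemma Aadj_add (y z : Fin m → ℝ) : D.Aadj (y + z) = D.Aadj y + D.Aadj z := by
  simp [Aadj, add_smul, Finset.sum_add_distrib]

lemma Aadj_smul (c : ℝ) (y : Fin m → ℝ) : D.Aadj (c • y) = c • D.Aadj y := by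
  simp [Aadj, Finset.smul_sum, mul_smul]

lemma Aadj_isSymm (y : Fin m → ℝ) : (D.Aadj y).IsSymm := by
  rw [Matrix.IsSymm, Aadj, Matrix.transpose_sum]
  exact Finset.sum_congr rfl fun i _ => by rw [Matrix.transpose_smul, (D.symm_A i).eq]

lemma frobInner_Aadj (y : Fin m → ℝ) (X : Matrix (Fin n) (Fin n) ℝ) :
    frobInner (D.Aadj y) X = D.Amap X ⬝ᵥ y := by
  have : frobInner (D.Aadj y) X = ∑ i, frobInner (y i • D.A i) X := by
    simp [frobInner, Aadj, Matrix.transpose_sum, Matrix.sum_mul, Matrix.trace_sum]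
  rw [this]
  refine Finset.sum_congr rfl fun i _ => ?_
  rw [frobInner_smul_left, mul_comm]
  rfl

variable {D}

lemma Aadj_eq_zero (hlin : LinearIndependent ℝ D.A) {y : Fin m → ℝ} (h : D.Aadj y = 0) :
    y = 0 :=
  funext (Fintype.linearIndependent_iff.1 hlin y h)

/-- Linear independence of the `Aᵢ` makes the Gram operator `𝒜𝒜*` injective, hence bijective. -/
lemma AmapLin_surjective (hlin : LinearIndependent ℝ D.A) :
    Function.Surjective D.AmapLin := by
  let B : (Fin m → ℝ) →ₗ[ℝ] (Fin m → ℝ) :=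
    D.AmapLin ∘ₗ { toFun := D.Aadj, map_add' := D.Aadj_add, map_smul' := D.Aadj_smul }
  have hB : Function.Injective B := by
    rw [injective_iff_map_eq_zero]
    intro y hy
    refine Aadj_eq_zero hlin ?_
    have h1 : D.Amap (D.Aadj y) = 0 := hy
    have h2 := D.frobInner_Aadj y (D.Aadj y)
    rw [h1, zero_dotProduct, ← frobSq, ← norm_sq_eq_frobSq] at h2
    simpa using h2
  intro z
  obtain ⟨y, hy⟩ := LinearMap.injective_iff_surjective.1 hB z
  exact ⟨D.Aadj y, hy⟩

lemma frobInner_C_eq {q : (Fin m → ℝ) × Matrix (Fin n) (Fin n) ℝ}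
    (hq : q.2 + D.Aadj q.1 = D.C) {X : Matrix (Fin n) (Fin n) ℝ} (hX : D.Amap X = D.b) :
    frobInner D.C X = D.b ⬝ᵥ q.1 + frobInner q.2 X := by
  rw [← hq, frobInner_add_left, D.frobInner_Aadj, hX, add_comm]

/-- The matrices, not necessarily symmetric, whose quadratic form is bounded below by a positive
multiple of the identity. They form an open convex set. -/
def strictCone (n : ℕ) : Set (Matrix (Fin n) (Fin n) ℝ) :=
  {X | ∃ τ : ℝ, 0 < τ ∧ ∀ x : Fin n → ℝ, τ * (x ⬝ᵥ x) ≤ x ⬝ᵥ X *ᵥ x}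

lemma dotProduct_self_nonneg' {ι : Type*} [Fintype ι] (x : ι → ℝ) : 0 ≤ x ⬝ᵥ x :=
  Finset.sum_nonneg fun _ _ => mul_self_nonneg _

lemma norm_vecMulVec_self (x : Fin n → ℝ) : ‖Matrix.vecMulVec x x‖ = x ⬝ᵥ x := by
  have h : ‖Matrix.vecMulVec x x‖ ^ 2 = (x ⬝ᵥ x) ^ 2 := by
    rw [norm_sq_eq_frobSq, frobSq, frobInner_mulVec_self, Matrix.vecMulVec_mulVec]
    simp [sq]
  exact (pow_left_inj₀ (norm_nonneg _) (dotProduct_self_nonneg' x) two_ne_zero).1 h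

lemma abs_quadForm_le (X : Matrix (Fin n) (Fin n) ℝ) (x : Fin n → ℝ) :
    |x ⬝ᵥ X *ᵥ x| ≤ ‖X‖ * (x ⬝ᵥ x) := by
  rw [← frobInner_mulVec_self, ← norm_vecMulVec_self, mul_comm]
  exact abs_frobInner_le _ _

lemma isOpen_strictCone : IsOpen (strictCone n) := by
  refine Metric.isOpen_iff.2 ?_
  rintro X ⟨τ, hτ, hX⟩
  refine ⟨τ / 2, by positivity, fun Y hY => ⟨τ / 2, by positivity, fun x => ?_⟩⟩
  rw [Metric.mem_ball, dist_eq_norm] at hY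
  have h1 := abs_le.1 (abs_quadForm_le (Y - X) x)
  rw [Matrix.sub_mulVec, dotProduct_sub] at h1
  nlinarith [hX x, dotProduct_self_nonneg' x, h1.1]

lemma convex_strictCone : Convex ℝ (strictCone n) := by
  rintro X ⟨τ, hτ, hX⟩ Y ⟨σ, hσ, hY⟩ a b ha hb hab
  refine ⟨min τ σ, lt_min hτ hσ, fun x => ?_⟩
  rw [Matrix.add_mulVec, dotProduct_add, Matrix.smul_mulVec, Matrix.smul_mulVec,
    dotProduct_smul, dotProduct_smul, smul_eq_mul, smul_eq_mul]
  have h0 := dotProduct_self_nonneg' x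
  have h1 : min τ σ * (x ⬝ᵥ x) ≤ x ⬝ᵥ X *ᵥ x :=
    (mul_le_mul_of_nonneg_right (min_le_left _ _) h0).trans (hX x)
  have h2 : min τ σ * (x ⬝ᵥ x) ≤ x ⬝ᵥ Y *ᵥ x :=
    (mul_le_mul_of_nonneg_right (min_le_right _ _) h0).trans (hY x)
  calc min τ σ * (x ⬝ᵥ x) = a * (min τ σ * (x ⬝ᵥ x)) + b * (min τ σ * (x ⬝ᵥ x)) := by
        rw [← add_mul, hab, one_mul]
    _ ≤ _ := by gcongr

lemma quadForm_nonneg {X : Matrix (Fin n) (Fin n) ℝ} (hX : X.PosSemidef) (x : Fin n → ℝ) :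
    0 ≤ x ⬝ᵥ X *ᵥ x :=
  (posSemidef_iff_quadForm hX.isSymm').1 hX x

lemma add_smul_one_mem_strictCone {X : Matrix (Fin n) (Fin n) ℝ} (hX : X.PosSemidef) {τ : ℝ}
    (hτ : 0 < τ) : X + τ • (1 : Matrix (Fin n) (Fin n) ℝ) ∈ strictCone n := by
  refine ⟨τ, hτ, fun x => ?_⟩
  rw [Matrix.add_mulVec, dotProduct_add, Matrix.smul_mulVec, Matrix.one_mulVec, dotProduct_smul,
    smul_eq_mul]
  linarith [quadForm_nonneg hX x]

lemma posDef_mem_strictCone {X : Matrix (Fin n) (Fin n) ℝ} (hX : X.PosDef) :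
    X ∈ strictCone n := by
  obtain ⟨τ, hτ, h⟩ := exists_posSemidef_sub_smul_one hX
  simpa using add_smul_one_mem_strictCone h hτ

lemma continuous_frobInner (C : Matrix (Fin n) (Fin n) ℝ) :
    Continuous fun X => frobInner C X := by
  unfold frobInner
  fun_prop

/-- The symmetric part of a matrix has the same inner product with every symmetric matrix. -/
lemma frobInner_symmPart {C : Matrix (Fin n) (Fin n) ℝ} (hC : C.IsSymm)
    (X : Matrix (Fin n) (Fin n) ℝ) :
    frobInner C ((1 / 2 : ℝ) • (X + Xᵀ)) = frobInner C X := by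
  rw [frobInner_smul_right, frobInner_add_right, ← frobInner_transpose, hC.eq]
  ring

lemma symmPart_posSemidef {X : Matrix (Fin n) (Fin n) ℝ} (hX : X ∈ strictCone n) :
    ((1 / 2 : ℝ) • (X + Xᵀ)).PosSemidef := by
  obtain ⟨τ, hτ, h⟩ := hX
  have hs : ((1 / 2 : ℝ) • (X + Xᵀ)).IsSymm := by
    rw [Matrix.IsSymm, Matrix.transpose_smul, Matrix.transpose_add, Matrix.transpose_transpose,
      add_comm]
  rw [posSemidef_iff_quadForm hs]
  intro x
  have h1 : x ⬝ᵥ Xᵀ *ᵥ x = x ⬝ᵥ X *ᵥ x := by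
    rw [Matrix.mulVec_transpose, dotProduct_comm, Matrix.dotProduct_mulVec]
  rw [Matrix.smul_mulVec, Matrix.add_mulVec, dotProduct_smul, dotProduct_add, h1, smul_eq_mul]
  nlinarith [h x, mul_nonneg hτ.le (dotProduct_self_nonneg' x)]

/-- Strong duality: under primal strict feasibility every lower bound of the primal program is
reached by a dual feasible point. The multiplier is found by separating `(b, 0)` from the open
convex set of all `(𝒜(X), r)` with `X` positive definite and `r > ⟨C, X⟩ - p`. -/
lemma exists_dualFeasible_ge (hlin : LinearIndependent ℝ D.A)
    {X₀ : Matrix (Fin n) (Fin n) ℝ} (hX₀ : X₀.PosDef) (hAX₀ : D.Amap X₀ = D.b) {p : ℝ}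
    (hp : ∀ X ∈ D.primalFeasible, p ≤ frobInner D.C X) :
    ∃ q ∈ D.dualFeasible, p ≤ D.b ⬝ᵥ q.1 := by
  let T : Set (Matrix (Fin n) (Fin n) ℝ × ℝ) :=
    {z | z.1 ∈ strictCone n ∧ frobInner D.C z.1 - p < z.2}
  let Lm : (Matrix (Fin n) (Fin n) ℝ × ℝ) →ₗ[ℝ] ((Fin m → ℝ) × ℝ) :=
    D.AmapLin.prodMap LinearMap.id
  have hTo : IsOpen T := by
    refine (isOpen_strictCone.preimage continuous_fst).inter ?_
    exact isOpen_lt (((continuous_frobInner D.C).comp continuous_fst).sub continuous_const)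
      continuous_snd
  have hTc : Convex ℝ T := by
    rintro ⟨X, r⟩ ⟨hX, hr⟩ ⟨Y, s⟩ ⟨hY, hs⟩ a b ha hb hab
    refine ⟨convex_strictCone hX hY ha hb hab, ?_⟩
    simp only [Prod.fst_add, Prod.smul_fst, Prod.snd_add, Prod.smul_snd, frobInner_add_right,
      frobInner_smul_right, smul_eq_mul] at hr hs ⊢
    have hb' : b = 1 - a := by linarith
    subst hb'
    rcases ha.eq_or_lt with h | h
    · subst h; linarith
    · nlinarith [mul_lt_mul_of_pos_left hr h, mul_le_mul_of_nonneg_left hs.le hb]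
  have hsurj : Function.Surjective Lm :=
    Function.Surjective.prodMap (AmapLin_surjective hlin) Function.surjective_id
  have hopen : IsOpen (Lm '' T) := LinearMap.isOpenMap_of_finiteDimensional Lm hsurj T hTo
  have hnot : ((D.b, 0) : (Fin m → ℝ) × ℝ) ∉ Lm '' T := by
    rintro ⟨⟨X, r⟩, ⟨hX, hr⟩, hz⟩
    have hAX : D.Amap X = D.b := congrArg Prod.fst hz
    have hr0 : r = 0 := congrArg Prod.snd hz
    have := hp _ ⟨symmPart_posSemidef hX, by
      ext i
      rw [Amap, frobInner_symmPart (D.symm_A i), ← hAX, Amap]⟩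
    rw [frobInner_symmPart D.symm_C] at this
    simp only at hr
    linarith
  obtain ⟨f, hf⟩ := geometric_hahn_banach_open_point (hTc.linear_image Lm) hopen hnot
  set κ : ℝ := f (0, 1) with hκ
  set l : Fin m → ℝ := fun i => f (Pi.single i 1, 0) with hl
  have hfz : ∀ (z : Fin m → ℝ) (r : ℝ), f (z, r) = z ⬝ᵥ l + r * κ := by
    intro z r
    have h1 : ((z, r) : (Fin m → ℝ) × ℝ) =
        ∑ i, z i • ((Pi.single i 1, 0) : (Fin m → ℝ) × ℝ) + r • ((0, 1) : (Fin m → ℝ) × ℝ) := by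
      refine Prod.ext ?_ ?_
      · ext j
        simp [Prod.fst_sum, Finset.sum_apply, Pi.single_apply]
      · simp [Prod.snd_sum]
    rw [h1, map_add, map_sum, map_smul]
    simp only [map_smul, smul_eq_mul, dotProduct, hl, hκ]
  have hmain : ∀ X ∈ strictCone n, ∀ r, frobInner D.C X - p < r →
      D.Amap X ⬝ᵥ l + r * κ < D.b ⬝ᵥ l := by
    intro X hX r hr
    have := hf _ ⟨(X, r), ⟨hX, hr⟩, rfl⟩
    change f (D.Amap X, r) < _ at this
    rw [hfz, hfz] at this
    linarith
  have hκneg : κ < 0 := by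
    have h1 := hmain X₀ (posDef_mem_strictCone hX₀) (frobInner D.C X₀ - p + 1) (by linarith)
    have h2 := hp X₀ ⟨hX₀.posSemidef, hAX₀⟩
    rw [hAX₀] at h1
    nlinarith
  have hbound : ∀ X ∈ strictCone n,
      p - D.b ⬝ᵥ ((-κ)⁻¹ • l) ≤ frobInner (D.C - D.Aadj ((-κ)⁻¹ • l)) X := by
    intro X hX
    rw [frobInner_sub_left, D.frobInner_Aadj, dotProduct_smul, dotProduct_smul, smul_eq_mul,
      smul_eq_mul]
    have h1 : (D.Amap X ⬝ᵥ l - D.b ⬝ᵥ l) * (-κ)⁻¹ ≤ frobInner D.C X - p := by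
      refine le_of_forall_gt_imp_ge_of_dense fun r hr => ?_
      have := hmain X hX r hr
      rw [← div_eq_mul_inv, div_le_iff₀ (by linarith)]
      linarith
    linarith
  set y := (-κ)⁻¹ • l
  -- Approximating a positive semidefinite matrix by positive definite ones.
  have hpsd : ∀ X : Matrix (Fin n) (Fin n) ℝ, X.PosSemidef →
      p - D.b ⬝ᵥ y ≤ frobInner (D.C - D.Aadj y) X := by
    intro X hX
    have hlim : Filter.Tendsto (fun ε : ℝ => frobInner (D.C - D.Aadj y) X
        + ε * (D.C - D.Aadj y).trace) (nhdsWithin 0 (Set.Ioi 0))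
        (nhds (frobInner (D.C - D.Aadj y) X + 0 * (D.C - D.Aadj y).trace)) := by
      refine Filter.Tendsto.mono_left ?_ nhdsWithin_le_nhds
      exact (continuous_const.add (continuous_id.mul continuous_const)).tendsto 0
    rw [zero_mul, add_zero] at hlim
    refine ge_of_tendsto hlim ?_
    filter_upwards [self_mem_nhdsWithin] with ε hε
    have := hbound _ (add_smul_one_mem_strictCone hX hε)
    rwa [frobInner_add_right, frobInner_smul_right, frobInner_one_right] at this
  refine ⟨(y, D.C - D.Aadj y), ⟨by simp, ?_⟩, ?_⟩
  · refine (posSemidef_iff_quadForm (D.symm_C.sub (D.Aadj_isSymm y))).2 fun x => ?_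
    by_contra! hneg
    -- A negative value of the quadratic form, scaled up, would violate the lower bound.
    set a := x ⬝ᵥ (D.C - D.Aadj y) *ᵥ x with ha
    obtain ⟨s, hs⟩ := exists_nat_gt ((p - D.b ⬝ᵥ y) / a)
    have h2 := hpsd ((s : ℝ) • Matrix.vecMulVec x x)
      ((by simpa using Matrix.posSemidef_vecMulVec_self_star x :
        (Matrix.vecMulVec x x).PosSemidef).smul (Nat.cast_nonneg s))
    rw [frobInner_smul_right, frobInner_comm, frobInner_mulVec_self, ← ha] at h2
    rw [div_lt_iff_of_neg hneg] at hs
    linarith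
  · have := hpsd 0 Matrix.PosSemidef.zero
    rw [frobInner_zero_right] at this
    linarith

lemma isClosed_posSemidef : IsClosed {X : Matrix (Fin n) (Fin n) ℝ | X.PosSemidef} := by
  have : {X : Matrix (Fin n) (Fin n) ℝ | X.PosSemidef} =
      {X | Xᵀ = X} ∩ ⋂ x : Fin n → ℝ, {X | 0 ≤ x ⬝ᵥ X *ᵥ x} := by
    ext X
    simp only [Set.mem_ofPred_eq, Set.mem_inter_iff, Set.mem_iInter]
    exact ⟨fun h => ⟨h.isSymm', quadForm_nonneg h⟩, fun h => (posSemidef_iff_quadForm h.1).2 h.2⟩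
  rw [this]
  refine (isClosed_eq (by fun_prop) continuous_id).inter (isClosed_iInter fun x => ?_)
  exact isClosed_le continuous_const (by fun_prop)

lemma continuous_Amap : Continuous D.Amap :=
  continuous_pi fun i => continuous_frobInner (D.A i)

lemma mul_trace_le_frobInner {Z X : Matrix (Fin n) (Fin n) ℝ} {τ : ℝ}
    (hZ : (Z - τ • (1 : Matrix (Fin n) (Fin n) ℝ)).PosSemidef) (hX : X.PosSemidef) :
    τ * X.trace ≤ frobInner Z X := by
  have := frobInner_nonneg hZ hX
  rw [frobInner_sub_left, frobInner_smul_left, frobInner_one_left] at this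
  linarith

/-- Under strict feasibility of both programs both optima are attained, with equal values. -/
lemma exists_optimal_pair (hlin : LinearIndependent ℝ D.A) (hs : D.Slater) :
    ∃ X ∈ D.primalOptimal, ∃ q ∈ D.dualOptimal, frobInner D.C X = D.b ⬝ᵥ q.1 := by
  obtain ⟨⟨X₀, hX₀, hAX₀⟩, y₀, Z₀, hZ₀, hyZ⟩ := hs
  obtain ⟨τ, hτ, hZτ⟩ := exists_posSemidef_sub_smul_one hZ₀
  have hval : ∀ X, D.Amap X = D.b → frobInner D.C X = D.b ⬝ᵥ y₀ + frobInner Z₀ X :=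
    fun X hX => frobInner_C_eq (q := (y₀, Z₀)) hyZ hX
  set K := {X | X ∈ D.primalFeasible ∧ frobInner D.C X ≤ frobInner D.C X₀} with hK
  have hcpt : IsCompact K := by
    refine Metric.isCompact_of_isClosed_isBounded ?_ ?_
    · refine (isClosed_posSemidef.inter (isClosed_eq continuous_Amap continuous_const)).inter
        (isClosed_le (continuous_frobInner D.C) continuous_const)
    · refine isBounded_iff_forall_norm_le.2 ⟨(frobInner D.C X₀ - D.b ⬝ᵥ y₀) / τ, ?_⟩
      rintro X ⟨⟨hX, hAX⟩, hCX⟩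
      refine (norm_le_trace hX).trans ?_
      rw [le_div_iff₀ hτ]
      linarith [mul_trace_le_frobInner hZτ hX, hval X hAX]
  obtain ⟨X, hX, hmin⟩ := hcpt.exists_isMinOn ⟨X₀, ⟨hX₀.posSemidef, hAX₀⟩, le_rfl⟩
    (continuous_frobInner D.C).continuousOn
  have hopt : ∀ X' ∈ D.primalFeasible, frobInner D.C X ≤ frobInner D.C X' := by
    intro X' hX'
    rcases le_total (frobInner D.C X') (frobInner D.C X₀) with h | h
    · exact hmin ⟨hX', h⟩
    · exact hX.2.trans h
  obtain ⟨q, hq, hpq⟩ := exists_dualFeasible_ge hlin hX₀ hAX₀ hopt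
  have hweak : ∀ q' ∈ D.dualFeasible, D.b ⬝ᵥ q'.1 ≤ frobInner D.C X := by
    intro q' hq'
    have := frobInner_C_eq hq'.1 hX.1.2
    linarith [frobInner_nonneg hq'.2 hX.1.1]
  exact ⟨X, ⟨hX.1, hopt⟩, q, ⟨hq, fun q' hq' => (hweak q' hq').trans hpq⟩,
    le_antisymm hpq (hweak q hq)⟩

/-- All primal and dual optimal solutions have the same value. -/
lemma optimal_value_eq (hlin : LinearIndependent ℝ D.A) (hs : D.Slater)
    {X : Matrix (Fin n) (Fin n) ℝ} (hX : X ∈ D.primalOptimal)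
    {q : (Fin m → ℝ) × Matrix (Fin n) (Fin n) ℝ} (hq : q ∈ D.dualOptimal) :
    frobInner D.C X = D.b ⬝ᵥ q.1 := by
  obtain ⟨X', hX', q', hq', h⟩ := exists_optimal_pair hlin hs
  linarith [hX.2 X' hX'.1, hX'.2 X hX.1, hq.2 q' hq'.1, hq'.2 q hq.1]

lemma maxDualTrace_nonneg : 0 ≤ D.maxDualTrace := by
  refine Real.sSup_nonneg ?_
  rintro _ ⟨q, hq, rfl⟩
  exact hq.1.2.trace_nonneg

lemma trace_le_maxDualTrace (hs : D.Slater) {q : (Fin m → ℝ) × Matrix (Fin n) (Fin n) ℝ}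
    (hq : q ∈ D.dualOptimal) : q.2.trace ≤ D.maxDualTrace := by
  obtain ⟨⟨X₀, hX₀, hAX₀⟩, -⟩ := hs
  obtain ⟨τ, hτ, hXτ⟩ := exists_posSemidef_sub_smul_one hX₀
  refine le_csSup ⟨(frobInner D.C X₀ - D.b ⬝ᵥ q.1) / τ, ?_⟩ ⟨q, hq, rfl⟩
  rintro _ ⟨q', hq', rfl⟩
  have h1 := mul_trace_le_frobInner hXτ hq'.1.2
  have h2 := frobInner_C_eq hq'.1.1 hAX₀
  rw [frobInner_comm] at h1
  show q'.2.trace ≤ _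
  rw [le_div_iff₀ hτ]
  linarith [hq'.2 q hq.1]

/-! ### The penalty function -/

lemma F_eq_of_posSemidef (ρ : ℝ) {X : Matrix (Fin n) (Fin n) ℝ} (hX : X.PosSemidef) :
    D.F ρ X = frobInner D.C X := by
  rw [F, max_eq_right (lamMax_neg_nonpos hX), mul_zero, add_zero]

/-- Exactness of the penalty: above the trace of a dual solution, `F` minus the optimal value
controls the primal infeasibility. -/
lemma max_lamMax_le_F_sub {ρ : ℝ} {q : (Fin m → ℝ) × Matrix (Fin n) (Fin n) ℝ}
    (hq : q ∈ D.dualFeasible) (hρ : q.2.trace + 1 ≤ ρ)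
    {X : Matrix (Fin n) (Fin n) ℝ} (hX : X ∈ D.affineSet) :
    max (lamMax (-X)) 0 ≤ D.F ρ X - D.b ⬝ᵥ q.1 := by
  have h1 := frobInner_nonneg hq.2 (posSemidef_add_smul_one hX.1)
  rw [frobInner_add_right, frobInner_smul_right, frobInner_one_right] at h1
  rw [F, frobInner_C_eq hq.1 hX.2]
  nlinarith [le_max_right (lamMax (-X)) 0]

lemma frobInner_dual_le_F_sub {ρ : ℝ} {q : (Fin m → ℝ) × Matrix (Fin n) (Fin n) ℝ}
    (hq : q ∈ D.dualFeasible) (hρ : q.2.trace + 1 ≤ ρ)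
    {X : Matrix (Fin n) (Fin n) ℝ} (hX : X ∈ D.affineSet) :
    frobInner q.2 (X + max (lamMax (-X)) 0 • (1 : Matrix (Fin n) (Fin n) ℝ)) ≤
      D.F ρ X - D.b ⬝ᵥ q.1 := by
  rw [F, frobInner_C_eq hq.1 hX.2, frobInner_add_right, frobInner_smul_right,
    frobInner_one_right]
  nlinarith [le_max_right (lamMax (-X)) 0]

/-- Sublevel sets of the penalty function on the affine set are bounded. -/
lemma exists_bound_of_F_le (hs : D.Slater) {ρ : ℝ}
    {q : (Fin m → ℝ) × Matrix (Fin n) (Fin n) ℝ}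
    (hq : q ∈ D.dualFeasible) (hρ : q.2.trace + 1 ≤ ρ) (M : ℝ) :
    ∃ R : ℝ, 0 ≤ R ∧ ∀ X ∈ D.affineSet, D.F ρ X - D.b ⬝ᵥ q.1 ≤ M →
      ‖X‖ ≤ R ∧ (X + max (lamMax (-X)) 0 • (1 : Matrix (Fin n) (Fin n) ℝ)).trace ≤ R := by
  obtain ⟨-, y₀, Z₀, hZ₀, hyZ⟩ := hs
  obtain ⟨τ, hτ, hZτ⟩ := exists_posSemidef_sub_smul_one hZ₀
  set T := (M + D.b ⬝ᵥ q.1 - D.b ⬝ᵥ y₀ + M * Z₀.trace) / τ with hT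
  refine ⟨max 0 (T + |M| * ‖(1 : Matrix (Fin n) (Fin n) ℝ)‖), le_max_left _ _, fun X hX hF => ?_⟩
  have hμ := max_lamMax_le_F_sub hq hρ hX
  have hμ0 := le_max_right (lamMax (-X)) 0
  have hpsd := posSemidef_add_smul_one hX.1
  have hval := frobInner_C_eq (q := (y₀, Z₀)) hyZ hX.2
  have htr : (X + max (lamMax (-X)) 0 • (1 : Matrix (Fin n) (Fin n) ℝ)).trace ≤ T := by
    have h1 := mul_trace_le_frobInner hZτ hpsd
    rw [hT, le_div_iff₀ hτ]
    have h2 := hZ₀.posSemidef.trace_nonneg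
    rw [frobInner_add_right, frobInner_smul_right, frobInner_one_right] at h1
    have h3 : frobInner D.C X ≤ D.F ρ X := by
      rw [F]
      have : 0 ≤ ρ := by linarith [hq.2.trace_nonneg]
      nlinarith
    simp only at hval
    nlinarith
  refine ⟨le_max_of_le_right ?_, le_max_of_le_right (htr.trans ?_)⟩
  · have h4 : ‖X‖ ≤ ‖X + max (lamMax (-X)) 0 • (1 : Matrix (Fin n) (Fin n) ℝ)‖ +
        ‖max (lamMax (-X)) 0 • (1 : Matrix (Fin n) (Fin n) ℝ)‖ := by
      simpa using norm_sub_le (X + max (lamMax (-X)) 0 • (1 : Matrix (Fin n) (Fin n) ℝ))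
        (max (lamMax (-X)) 0 • (1 : Matrix (Fin n) (Fin n) ℝ))
    rw [norm_smul, Real.norm_of_nonneg hμ0] at h4
    have h5 := (norm_le_trace hpsd).trans htr
    have h6 := norm_nonneg (1 : Matrix (Fin n) (Fin n) ℝ)
    have h7 : max (lamMax (-X)) 0 * ‖(1 : Matrix (Fin n) (Fin n) ℝ)‖ ≤
        |M| * ‖(1 : Matrix (Fin n) (Fin n) ℝ)‖ := by
      gcongr
      linarith [le_abs_self M]
    linarith
  · have h6 := norm_nonneg (1 : Matrix (Fin n) (Fin n) ℝ)
    have h9 := mul_nonneg (abs_nonneg M) h6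
    linarith

end SDP

/-! ### Quadratic growth under strict complementarity -/

section Growth

variable {n : ℕ}

lemma norm_mul_sq_eq {E R : Matrix (Fin n) (Fin n) ℝ} (hE : E.IsSymm) (hR : R.IsSymm) :
    ‖E * R‖ ^ 2 = frobInner (E * E) (R * R) := by
  rw [norm_sq_eq_frobSq, frobSq, frobInner, frobInner, Matrix.transpose_mul, Matrix.transpose_mul,
    hE.eq, hR.eq, Matrix.mul_assoc R E, Matrix.trace_mul_comm R]
  simp only [Matrix.mul_assoc]

lemma mul_eq_zero_of_frobInner_eq_zero {X Z : Matrix (Fin n) (Fin n) ℝ} (hX : X.PosSemidef)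
    (hZ : Z.PosSemidef) (h : frobInner Z X = 0) : Z * X = 0 := by
  obtain ⟨R, hR, rfl⟩ := exists_isSymm_mul_self hX
  obtain ⟨T, hT, rfl⟩ := exists_isSymm_mul_self hZ
  have h1 : T * R = 0 := by
    rw [← norm_mul_sq_eq hT hR] at h
    simpa using h
  calc T * T * (R * R) = T * (T * R) * R := by simp only [Matrix.mul_assoc]
    _ = 0 := by simp [h1]

/-- Strict complementarity says exactly that `X + Z` is positive definite. -/
lemma posDef_add_of_rank_add_rank {X Z : Matrix (Fin n) (Fin n) ℝ} (hX : X.PosSemidef)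
    (hZ : Z.PosSemidef) (hZX : Z * X = 0) (hr : X.rank + Z.rank = n) : (X + Z).PosDef := by
  rw [(hX.add hZ).posDef_iff_isUnit, ← Matrix.mulVec_injective_iff_isUnit]
  have hker : LinearMap.range X.mulVecLin = LinearMap.ker Z.mulVecLin := by
    refine Submodule.eq_of_le_of_finrank_eq ?_ ?_
    · rintro _ ⟨w, rfl⟩
      simp [Matrix.mulVec_mulVec, hZX]
    · have h1 := LinearMap.finrank_range_add_finrank_ker Z.mulVecLin
      rw [Module.finrank_fin_fun] at h1
      change X.rank = _
      change Z.rank + _ = _ at h1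
      omega
  refine (injective_iff_map_eq_zero (X + Z).mulVecLin).2 fun v hv => ?_
  rw [Matrix.mulVecLin_apply, Matrix.add_mulVec] at hv
  have h1 : v ⬝ᵥ X *ᵥ v + v ⬝ᵥ Z *ᵥ v = 0 := by rw [← dotProduct_add, hv, dotProduct_zero]
  have hXv : X *ᵥ v = 0 := by
    rw [← hX.dotProduct_mulVec_zero_iff, star_trivial]
    linarith [SDP.quadForm_nonneg hX v, SDP.quadForm_nonneg hZ v]
  have hZv : v ∈ LinearMap.ker Z.mulVecLin := by
    rw [hXv, zero_add] at hv
    simpa using hv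
  rw [← hker] at hZv
  obtain ⟨w, hw⟩ := hZv
  rw [Matrix.mulVecLin_apply] at hw
  have h2 : v ⬝ᵥ v = 0 := by
    conv_lhs => rw [← hw, Matrix.dotProduct_mulVec, ← Matrix.mulVec_transpose, hX.isSymm'.eq, hw,
      hXv]
    simp
  exact dotProduct_self_eq_zero.1 h2

/-- For a strictly complementary pair, `Π = X (X + Z)⁻¹` is the orthogonal projector onto the
range of `X`, which is the kernel of `Z`; on these complementary subspaces `X` and `Z` are bounded
below by a common `τ > 0`. -/
lemma exists_projector {X Z : Matrix (Fin n) (Fin n) ℝ} (hX : X.PosSemidef)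
    (hZ : Z.PosSemidef) (hZX : Z * X = 0) (hXZ : (X + Z).PosDef) :
    ∃ (E : Matrix (Fin n) (Fin n) ℝ) (τ : ℝ), 0 < τ ∧ E.IsSymm ∧ E * E = E ∧ Z * E = 0 ∧
      E * X * E = X ∧ (X - τ • E).PosSemidef ∧ (Z - τ • (1 - E)).PosSemidef := by
  obtain ⟨τ, hτ, hτM⟩ := exists_posSemidef_sub_smul_one hXZ
  have hXZ0 : X * Z = 0 := by
    have := congrArg Matrix.transpose hZX
    rwa [Matrix.transpose_mul, hX.isSymm'.eq, hZ.isSymm'.eq, Matrix.transpose_zero] at this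
  set M := X + Z with hM
  have hMs : M.IsSymm := hXZ.posSemidef.isSymm'
  have hdet : IsUnit M.det := (Matrix.isUnit_iff_isUnit_det M).1 hXZ.isUnit
  have hcX : M * X = X * M := by rw [hM, Matrix.add_mul, Matrix.mul_add, hZX, hXZ0]
  have hcZ : M * Z = Z * M := by rw [hM, Matrix.add_mul, Matrix.mul_add, hZX, hXZ0]
  have hinv : ∀ B, M * B = B * M → M⁻¹ * B = B * M⁻¹ := fun B hB => by
    calc M⁻¹ * B = M⁻¹ * (B * M) * M⁻¹ := by
          rw [Matrix.mul_assoc, Matrix.mul_assoc, Matrix.mul_nonsing_inv _ hdet, Matrix.mul_one]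
      _ = B * M⁻¹ := by
          rw [← hB, ← Matrix.mul_assoc M⁻¹, Matrix.nonsing_inv_mul _ hdet, Matrix.one_mul]
  have hMis : (M⁻¹)ᵀ = M⁻¹ := by rw [Matrix.transpose_nonsing_inv, hMs.eq]
  set E := X * M⁻¹ with hE
  set N := Z * M⁻¹ with hN
  have hEN : E + N = 1 := by rw [hE, hN, ← Matrix.add_mul, Matrix.mul_nonsing_inv _ hdet]
  have hN1 : 1 - E = N := by rw [← hEN]; abel
  have hEs : E.IsSymm := by
    rw [Matrix.IsSymm, hE, Matrix.transpose_mul, hMis, hX.isSymm'.eq, hinv X hcX]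
  have hNs : N.IsSymm := by
    rw [Matrix.IsSymm, hN, Matrix.transpose_mul, hMis, hZ.isSymm'.eq, hinv Z hcZ]
  have hZE : Z * E = 0 := by rw [hE, ← Matrix.mul_assoc, hZX, Matrix.zero_mul]
  have hXN : X * N = 0 := by rw [hN, ← Matrix.mul_assoc, hXZ0, Matrix.zero_mul]
  have hXE : X * E = X := by
    have := congrArg (X * ·) hEN
    simpa [Matrix.mul_add, hXN] using this
  have hZN : Z * N = Z := by
    have := congrArg (Z * ·) hEN
    simpa [Matrix.mul_add, hZE] using this
  have hEX : E * X = X := by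
    have := congrArg Matrix.transpose hXE
    rwa [Matrix.transpose_mul, hX.isSymm'.eq, hEs.eq] at this
  have hEZ : E * Z = 0 := by
    have := congrArg Matrix.transpose hZE
    rwa [Matrix.transpose_mul, hZ.isSymm'.eq, hEs.eq, Matrix.transpose_zero] at this
  have hNX : N * X = 0 := by
    have := congrArg Matrix.transpose hXN
    rwa [Matrix.transpose_mul, hX.isSymm'.eq, hNs.eq, Matrix.transpose_zero] at this
  have hNZ : N * Z = Z := by
    have := congrArg Matrix.transpose hZN
    rwa [Matrix.transpose_mul, hZ.isSymm'.eq, hNs.eq] at this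
  have hEE : E * E = E := by rw [hE, ← Matrix.mul_assoc, ← hE, hEX]
  have hNN : N * N = N := by rw [hN, ← Matrix.mul_assoc, ← hN, hNZ]
  refine ⟨E, τ, hτ, hEs, hEE, hZE, by rw [hEX, hXE], ?_, ?_⟩
  · have := hτM.mul_mul_conjTranspose_same E
    rw [Matrix.conjTranspose_eq_transpose_of_trivial, hEs.eq] at this
    convert this using 1
    rw [Matrix.mul_sub, Matrix.sub_mul, hM, Matrix.mul_add, hEX, hEZ, add_zero, hXE]
    simp [hEE]
  · have := hτM.mul_mul_conjTranspose_same N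
    rw [Matrix.conjTranspose_eq_transpose_of_trivial, hNs.eq] at this
    convert this using 1
    rw [hN1, Matrix.mul_sub, Matrix.sub_mul, hM, Matrix.mul_add, hNX, hNZ, zero_add, hZN]
    simp [hNN]

/-- A positive semidefinite matrix is close to its compression to the kernel of `Z` when its inner
product with `Z` is small. -/
lemma norm_sub_compression_le {X Z E : Matrix (Fin n) (Fin n) ℝ} {τ δ R : ℝ} (hτ : 0 < τ)
    (hX : X.PosSemidef) (hE : E.IsSymm) (hEE : E * E = E)
    (hZ : (Z - τ • (1 - E)).PosSemidef) (hδ : frobInner Z X ≤ δ) (hR : X.trace ≤ R) :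
    ‖X - E * X * E‖ ≤ 2 * √(R / τ) * √δ := by
  have hN : (1 - E).IsSymm := Matrix.isSymm_one.sub hE
  have hNN : (1 - E) * (1 - E) = 1 - E := by
    rw [Matrix.mul_sub, Matrix.sub_mul, Matrix.sub_mul, hEE]
    simp
  have h1 : frobInner (1 - E) X ≤ δ / τ := by
    have := frobInner_nonneg hZ hX
    rw [frobInner_sub_left, frobInner_smul_left] at this
    rw [le_div_iff₀ hτ]
    linarith
  obtain ⟨T, hT, rfl⟩ := exists_isSymm_mul_self hX
  have hNT : ‖(1 - E) * T‖ ≤ √(δ / τ) := by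
    refine Real.le_sqrt_of_sq_le ?_
    rwa [norm_mul_sq_eq hN hT, hNN]
  have hTn : ‖T‖ ≤ √R := by
    refine Real.le_sqrt_of_sq_le ?_
    rwa [norm_sq_eq_trace_mul_self hT]
  have hET : ‖E * T‖ ≤ √R := by
    refine Real.le_sqrt_of_sq_le ?_
    rw [norm_mul_sq_eq hE hT, hEE]
    have h2 : 0 ≤ frobInner (1 - E) (T * T) := by
      rw [← hNN, ← norm_mul_sq_eq hN hT]
      positivity
    rw [frobInner_sub_left, frobInner_one_left] at h2
    linarith
  have hTN : ‖T * (1 - E)‖ ≤ √(δ / τ) := by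
    rw [← Matrix.frobenius_norm_transpose, Matrix.transpose_mul, hN.eq, hT.eq]
    exact hNT
  have hsplit : T * T - E * (T * T) * E = (1 - E) * T * T + E * T * (T * (1 - E)) := by
    noncomm_ring
  rw [hsplit]
  calc ‖(1 - E) * T * T + E * T * (T * (1 - E))‖
      ≤ ‖(1 - E) * T‖ * ‖T‖ + ‖E * T‖ * ‖T * (1 - E)‖ :=
        (norm_add_le _ _).trans (add_le_add (Matrix.frobenius_norm_mul _ _)
          (Matrix.frobenius_norm_mul _ _))
    _ ≤ √(δ / τ) * √R + √R * √(δ / τ) := by gcongr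
    _ = 2 * √(R / τ) * √δ := by
        have hR0 : 0 ≤ R := hX.trace_nonneg.trans hR
        rw [Real.sqrt_div' _ hτ.le, Real.sqrt_div' _ hτ.le]
        ring

/-- On its range, a linear map between finite-dimensional spaces has preimages of controlled
norm. -/
lemma exists_norm_preimage_le {V W : Type*} [NormedAddCommGroup V] [NormedSpace ℝ V]
    [NormedAddCommGroup W] [NormedSpace ℝ W] [FiniteDimensional ℝ V] [FiniteDimensional ℝ W]
    (T : V →ₗ[ℝ] W) : ∃ c : ℝ, 0 ≤ c ∧ ∀ x, ∃ x', T x' = T x ∧ ‖x'‖ ≤ c * ‖T x‖ := by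
  obtain ⟨g, hg⟩ := T.rangeRestrict.exists_rightInverse_of_surjective T.range_rangeRestrict
  refine ⟨‖LinearMap.toContinuousLinearMap g‖, ContinuousLinearMap.opNorm_nonneg _,
    fun x => ⟨g (T.rangeRestrict x), ?_,
    (LinearMap.toContinuousLinearMap g).le_opNorm (T.rangeRestrict x)⟩⟩
  exact congrArg Subtype.val (LinearMap.congr_fun hg (T.rangeRestrict x))

/-- A Hoffman-type bound for a linear system: a point of the affine set is no farther from its
intersection with a face `{Y : E Y E = Y}` than a constant times its distance to the face. -/
lemma SDP.exists_hoffman {m : ℕ} (D : SDP n m) {E Xh : Matrix (Fin n) (Fin n) ℝ}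
    (hE : E.IsSymm) (hXh : Xh ∈ D.affineSet) (hEX : E * Xh * E = Xh) :
    ∃ c : ℝ, 0 ≤ c ∧ ∀ X ∈ D.affineSet, ∃ Y ∈ D.affineSet,
      E * Y * E = Y ∧ ‖X - Y‖ ≤ c * ‖X - E * X * E‖ := by
  let T : Matrix (Fin n) (Fin n) ℝ →ₗ[ℝ] (Fin m → ℝ) × Matrix (Fin n) (Fin n) ℝ :=
    D.AmapLin.prod (LinearMap.id - (LinearMap.mulRight ℝ E ∘ₗ LinearMap.mulLeft ℝ E))
  have hT : ∀ X, T X = (D.Amap X, X - E * X * E) := fun X => rfl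
  obtain ⟨c, hc, h⟩ := exists_norm_preimage_le T
  refine ⟨c, hc, fun X hX => ?_⟩
  obtain ⟨H, hH, hHn⟩ := h (X - Xh)
  have hTX : T (X - Xh) = (0, X - E * X * E) := by
    rw [hT, D.Amap_sub, hX.2, hXh.2, sub_self, Matrix.mul_sub, Matrix.sub_mul, hEX]
    congr 1
    abel
  rw [hTX, Prod.norm_mk, norm_zero, max_eq_right (norm_nonneg _)] at hHn
  rw [hTX, hT, Prod.mk.injEq] at hH
  obtain ⟨hH1, hH2⟩ := hH
  have hHt : Hᵀ - E * Hᵀ * E = X - E * X * E := by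
    have := congrArg Matrix.transpose hH2
    simp only [Matrix.transpose_sub, Matrix.transpose_mul, hE.eq, hX.1.eq] at this
    rw [Matrix.mul_assoc, Matrix.mul_assoc, this]
  refine ⟨X - (1 / 2 : ℝ) • (H + Hᵀ), ⟨hX.1.sub ?_, ?_⟩, ?_, ?_⟩
  · rw [Matrix.IsSymm, Matrix.transpose_smul, Matrix.transpose_add, Matrix.transpose_transpose,
      add_comm]
  · rw [D.Amap_sub, D.Amap_smul, D.Amap_add, D.Amap_transpose, hH1, hX.2]
    simp
  · have h3 : (1 / 2 : ℝ) • (H + Hᵀ) - E * ((1 / 2 : ℝ) • (H + Hᵀ)) * E = X - E * X * E := by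
      calc _ = (1 / 2 : ℝ) • ((H - E * H * E) + (Hᵀ - E * Hᵀ * E)) := by
            simp only [Matrix.mul_smul, Matrix.smul_mul, Matrix.mul_add, Matrix.add_mul]
            module
        _ = _ := by rw [hH2, hHt]; module
    rw [Matrix.mul_sub, Matrix.sub_mul]
    rw [sub_eq_sub_iff_add_eq_add] at h3 ⊢
    rw [add_comm, ← h3, add_comm]
  · rw [sub_sub_cancel, norm_smul]
    have := norm_add_le H Hᵀ
    rw [Matrix.frobenius_norm_transpose] at this
    rw [Real.norm_of_nonneg (by norm_num)]
    linarith

/-- Quadratic growth: under strict complementarity, on a sublevel set of the penalty function the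
squared distance to the primal optimal set is at most a multiple of the cost gap. -/
lemma SDP.exists_quadratic_growth {m : ℕ} {D : SDP n m} (hlin : LinearIndependent ℝ D.A)
    (hs : D.Slater) (hsc : D.StrictComplementarity) {ρ p : ℝ}
    (hρ : ∀ q ∈ D.dualOptimal, q.2.trace + 1 ≤ ρ) (hp : ∀ q ∈ D.dualOptimal, D.b ⬝ᵥ q.1 = p)
    (M : ℝ) :
    ∃ κ : ℝ, 0 ≤ κ ∧ ∀ X ∈ D.affineSet, D.F ρ X - p ≤ M →
      ∃ Y ∈ D.primalOptimal, ‖X - Y‖ ^ 2 ≤ κ * (D.F ρ X - p) := by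
  obtain ⟨Xh, hXh, q, hq, hr⟩ := hsc
  have hslack := frobInner_C_eq hq.1.1 hXh.1.2
  rw [optimal_value_eq hlin hs hXh hq] at hslack
  have hZX := mul_eq_zero_of_frobInner_eq_zero hXh.1.1 hq.1.2 (by linarith)
  obtain ⟨E, τ, hτ, hEs, hEE, hZE, hEX, hXτ, hZτ⟩ := exists_projector hXh.1.1 hq.1.2 hZX
    (posDef_add_of_rank_add_rank hXh.1.1 hq.1.2 hZX hr)
  obtain ⟨c, hc, hhoff⟩ := D.exists_hoffman hEs ⟨hXh.1.1.isSymm', hXh.1.2⟩ hEX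
  obtain ⟨R, hR0, hR⟩ := exists_bound_of_F_le hs hq.1 (hρ q hq) M
  set c₁ := 2 * √(R / τ) + √M * ‖(1 : Matrix (Fin n) (Fin n) ℝ) - E‖ with hc₁
  set c₂ := c * c₁ with hc₂
  set c₃ := √M + c₂ with hc₃
  set c₄ := c₂ + c₃ / τ * (R + c₂ * √M + ‖Xh‖) with hc₄
  have hc₁0 : 0 ≤ c₁ := by positivity
  have hc₂0 : 0 ≤ c₂ := by positivity
  have hc₃0 : 0 ≤ c₃ := by positivity
  refine ⟨c₄ ^ 2, by positivity, fun X hX hF => ?_⟩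
  have hμ := max_lamMax_le_F_sub hq.1 (hρ q hq) hX
  have hZδ := frobInner_dual_le_F_sub hq.1 (hρ q hq) hX
  obtain ⟨hXR, htrR⟩ := hR X hX (by rwa [hp q hq])
  have hpsd := posSemidef_add_smul_one hX.1
  rw [hp q hq] at hμ hZδ
  set δ := D.F ρ X - p with hδ
  set μ := max (lamMax (-X)) 0 with hμdef
  have hμ0 : 0 ≤ μ := le_max_right _ _
  have hδ0 : 0 ≤ δ := hμ0.trans hμ
  have hμs : μ ≤ √M * √δ := by
    calc μ ≤ √δ * √δ := by rwa [Real.mul_self_sqrt hδ0]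
      _ ≤ √M * √δ := by gcongr
  have hcomp : ‖X - E * X * E‖ ≤ c₁ * √δ := by
    have h1 := norm_sub_compression_le hτ hpsd hEs hEE hZτ hZδ htrR
    have h2 : X - E * X * E = (X + μ • (1 : Matrix (Fin n) (Fin n) ℝ)
        - E * (X + μ • (1 : Matrix (Fin n) (Fin n) ℝ)) * E) - μ • (1 - E) := by
      rw [Matrix.mul_add, Matrix.add_mul, Matrix.mul_smul, Matrix.smul_mul, Matrix.mul_one, hEE]
      module
    rw [h2]
    refine (norm_sub_le _ _).trans ?_
    rw [norm_smul, Real.norm_of_nonneg hμ0, hc₁, add_mul]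
    refine add_le_add h1 ?_
    calc μ * ‖(1 : Matrix (Fin n) (Fin n) ℝ) - E‖
        ≤ (√M * √δ) * ‖(1 : Matrix (Fin n) (Fin n) ℝ) - E‖ := by gcongr
      _ = _ := by ring
  obtain ⟨Y, hY, hEY, hXY⟩ := hhoff X hX
  have hXY' : ‖X - Y‖ ≤ c₂ * √δ := by
    refine hXY.trans ?_
    rw [hc₂, mul_assoc c]
    exact mul_le_mul_of_nonneg_left hcomp hc
  set s := μ + ‖X - Y‖ with hs'
  have hs0 : 0 ≤ s := by positivity
  have hsb : s ≤ c₃ * √δ := by rw [hs', hc₃, add_mul]; exact add_le_add hμs hXY'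
  -- `Y` is positive semidefinite up to a multiple `s` of the projector.
  have hYs : (Y + s • E).PosSemidef := by
    have h1 : (‖X - Y‖ • (1 : Matrix (Fin n) (Fin n) ℝ) - (X - Y)).PosSemidef := by
      refine (posSemidef_iff_quadForm ((hX.1.sub hY.1).smul_one_sub _)).2 fun x => ?_
      rw [Matrix.sub_mulVec, dotProduct_sub, Matrix.smul_mulVec, Matrix.one_mulVec,
        dotProduct_smul, smul_eq_mul]
      linarith [(abs_le.1 (abs_quadForm_le (X - Y) x)).2]
    have h2 := (hpsd.add h1).mul_mul_conjTranspose_same E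
    rw [Matrix.conjTranspose_eq_transpose_of_trivial, hEs.eq] at h2
    convert h2 using 1
    have h3 : X + μ • (1 : Matrix (Fin n) (Fin n) ℝ) + (‖X - Y‖ • 1 - (X - Y)) = Y + s • 1 := by
      rw [hs']
      module
    rw [h3, Matrix.mul_add, Matrix.add_mul, hEY, Matrix.mul_smul, Matrix.mul_one,
      Matrix.smul_mul, hEE]
  -- Moving slightly towards `Xh` restores feasibility without leaving the optimal face.
  set θ := s / (τ + s) with hθ
  have hθ0 : 0 ≤ θ := by positivity
  have hθ1 : θ ≤ 1 := by rw [hθ, div_le_one (by positivity)]; linarith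
  have hθs : θ ≤ s / τ := by rw [hθ]; gcongr; linarith
  have hθeq : (1 - θ) * s = θ * τ := by
    rw [hθ]
    field_simp
    ring
  have hfeas : (1 - θ) • Y + θ • Xh ∈ D.primalFeasible := by
    refine ⟨?_, ?_⟩
    · have h1 := (hYs.smul (sub_nonneg.2 hθ1)).add (hXτ.smul hθ0)
      convert h1 using 1
      rw [smul_add, smul_sub, smul_smul, smul_smul, hθeq]
      abel
    · rw [D.Amap_add, D.Amap_smul, D.Amap_smul, hY.2, hXh.1.2, ← add_smul, sub_add_cancel,
        one_smul]
  have hZ0 : frobInner q.2 ((1 - θ) • Y + θ • Xh) = 0 := by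
    rw [frobInner, hq.1.2.isSymm'.eq, Matrix.mul_add, Matrix.mul_smul, Matrix.mul_smul, hZX, ← hEY,
      Matrix.mul_assoc E, ← Matrix.mul_assoc q.2, hZE]
    simp
  refine ⟨_, ⟨hfeas, fun X' hX' => ?_⟩, ?_⟩
  · rw [frobInner_C_eq hq.1.1 hfeas.2, hZ0, frobInner_C_eq hq.1.1 hX'.2]
    linarith [frobInner_nonneg hq.1.2 hX'.1]
  · have h1 : X - ((1 - θ) • Y + θ • Xh) = (X - Y) + θ • (Y - Xh) := by module
    have h2 : ‖Y - Xh‖ ≤ R + c₂ * √M + ‖Xh‖ := by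
      have h3 : Y - Xh = X - (X - Y) - Xh := by abel
      rw [h3]
      refine (norm_sub_le _ _).trans (add_le_add ((norm_sub_le _ _).trans
        (add_le_add hXR (hXY'.trans ?_))) le_rfl)
      gcongr
    have h4 : ‖X - ((1 - θ) • Y + θ • Xh)‖ ≤ c₄ * √δ := by
      rw [h1]
      calc _ ≤ ‖X - Y‖ + θ * ‖Y - Xh‖ := by
            refine (norm_add_le _ _).trans ?_
            rw [norm_smul, Real.norm_of_nonneg hθ0]
        _ ≤ c₂ * √δ + (c₃ * √δ / τ) * (R + c₂ * √M + ‖Xh‖) := by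
            gcongr
            exact hθs.trans (by gcongr)
        _ = c₄ * √δ := by rw [hc₄]; ring
    calc _ ≤ (c₄ * √δ) ^ 2 := by gcongr
      _ = _ := by rw [mul_pow, Real.sq_sqrt hδ0]

end Growth

/-! ### The lower model and its update -/

section Model

variable {n m r : ℕ} {Wbar : Matrix (Fin n) (Fin n) ℝ} {P : Matrix (Fin n) (Fin r) ℝ}

/-- The data `(W̄, P)` of a lower model are admissible: `W̄ ⪰ 0` has unit trace and `P` has
orthonormal columns. -/
def IsAdmissible (Wbar : Matrix (Fin n) (Fin n) ℝ) (P : Matrix (Fin n) (Fin r) ℝ) : Prop :=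
  Wbar.PosSemidef ∧ Wbar.trace = 1 ∧ Pᵀ * P = 1

lemma trace_mul_mul_transpose {k : ℕ} {V : Matrix (Fin n) (Fin k) ℝ} (hV : Vᵀ * V = 1)
    (S : Matrix (Fin k) (Fin k) ℝ) : (V * S * Vᵀ).trace = S.trace := by
  rw [Matrix.trace_mul_comm, ← Matrix.mul_assoc, hV, Matrix.one_mul]

lemma posSemidef_mul_mul_transpose {k : ℕ} (V : Matrix (Fin n) (Fin k) ℝ)
    {S : Matrix (Fin k) (Fin k) ℝ} (hS : S.PosSemidef) : (V * S * Vᵀ).PosSemidef := by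
  simpa using hS.mul_mul_conjTranspose_same V

lemma IsAdmissible.posSemidef (h : IsAdmissible Wbar P) {c : ℝ} {W : Matrix (Fin n) (Fin n) ℝ}
    (hW : W ∈ weightSet c Wbar P) : W.PosSemidef := by
  obtain ⟨γ, S, hγ, hS, -, rfl⟩ := hW
  exact (h.1.smul hγ).add (posSemidef_mul_mul_transpose P hS)

lemma IsAdmissible.trace_le (h : IsAdmissible Wbar P) {c : ℝ} {W : Matrix (Fin n) (Fin n) ℝ}
    (hW : W ∈ weightSet c Wbar P) : W.trace ≤ c := by
  obtain ⟨γ, S, hγ, hS, hc, rfl⟩ := hW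
  rwa [Matrix.trace_add, Matrix.trace_smul, h.2.1, trace_mul_mul_transpose h.2.2, smul_eq_mul,
    mul_one]

lemma IsAdmissible.norm_le (h : IsAdmissible Wbar P) {c : ℝ} {W : Matrix (Fin n) (Fin n) ℝ}
    (hW : W ∈ weightSet c Wbar P) : ‖W‖ ≤ c :=
  (norm_le_trace (h.posSemidef hW)).trans (h.trace_le hW)

lemma zero_mem_weightSet {c : ℝ} (hc : 0 ≤ c) :
    (0 : Matrix (Fin n) (Fin n) ℝ) ∈ weightSet c Wbar P :=
  ⟨0, 0, le_rfl, Matrix.PosSemidef.zero, by simpa using hc, by simp⟩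

lemma smul_mem_weightSet {a c : ℝ} (ha : 0 ≤ a) {W : Matrix (Fin n) (Fin n) ℝ}
    (hW : W ∈ weightSet c Wbar P) : a • W ∈ weightSet (a * c) Wbar P := by
  obtain ⟨γ, S, hγ, hS, hc, rfl⟩ := hW
  refine ⟨a * γ, a • S, by positivity, hS.smul ha, ?_, ?_⟩
  · rw [Matrix.trace_smul, smul_eq_mul, ← mul_add]
    gcongr
  · rw [smul_add, smul_smul, Matrix.mul_smul, Matrix.smul_mul]

lemma convex_weightSet (c : ℝ) : Convex ℝ (weightSet c Wbar P) := by
  rintro _ ⟨γ, S, hγ, hS, hc, rfl⟩ _ ⟨γ', S', hγ', hS', hc', rfl⟩ a b ha hb hab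
  refine ⟨a * γ + b * γ', a • S + b • S', by positivity, (hS.smul ha).add (hS'.smul hb), ?_, ?_⟩
  · rw [Matrix.trace_add, Matrix.trace_smul, Matrix.trace_smul, smul_eq_mul, smul_eq_mul]
    calc _ = a * (γ + S.trace) + b * (γ' + S'.trace) := by ring
      _ ≤ a * c + b * c := by gcongr
      _ = c := by rw [← add_mul, hab, one_mul]
  · simp only [Matrix.mul_add, Matrix.add_mul, Matrix.mul_smul, Matrix.smul_mul]
    module

variable (D : SDP n m) {ρ : ℝ} {X : Matrix (Fin n) (Fin n) ℝ}

lemma IsAdmissible.le_model (h : IsAdmissible Wbar P) (hρ : 0 < ρ) (hX : X.IsSymm)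
    {W : Matrix (Fin n) (Fin n) ℝ} (hW : W ∈ weightSet ρ Wbar P) :
    frobInner D.C X - frobInner W X ≤ D.model ρ Wbar P X := by
  have h1 : frobInner (ρ⁻¹ • W) (-X) ≤
      sSup ((fun W => frobInner W (-X)) '' weightSet 1 Wbar P) := by
    refine le_csSup ⟨1 * max (lamMax (-X)) 0, ?_⟩ ⟨_, ?_, rfl⟩
    · rintro _ ⟨V, hV, rfl⟩
      exact frobInner_le_mul_lamMax (h.posSemidef hV) hX.neg (h.trace_le hV)
    · simpa [hρ.ne'] using smul_mem_weightSet (inv_nonneg.2 hρ.le) hW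
  rw [frobInner_smul_left, frobInner_neg_right, inv_mul_le_iff₀ hρ] at h1
  rw [SDP.model]
  linarith

lemma SDP.model_le (hρ : 0 < ρ) {B : ℝ}
    (hB : ∀ W ∈ weightSet ρ Wbar P, frobInner D.C X - frobInner W X ≤ B) :
    D.model ρ Wbar P X ≤ B := by
  have : sSup ((fun W => frobInner W (-X)) '' weightSet 1 Wbar P) ≤
      ρ⁻¹ * (B - frobInner D.C X) := by
    refine csSup_le ⟨_, 0, zero_mem_weightSet zero_le_one, rfl⟩ ?_
    rintro _ ⟨V, hV, rfl⟩
    have h1 := hB (ρ • V) (by simpa using smul_mem_weightSet hρ.le hV)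
    rw [frobInner_smul_left] at h1
    simp only [frobInner_neg_right]
    rw [le_inv_mul_iff₀ hρ]
    linarith
  rw [le_inv_mul_iff₀ hρ] at this
  rw [SDP.model]
  linarith

lemma IsAdmissible.sub_le_F (h : IsAdmissible Wbar P) (hX : X.IsSymm)
    {W : Matrix (Fin n) (Fin n) ℝ} (hW : W ∈ weightSet ρ Wbar P) :
    frobInner D.C X - frobInner W X ≤ D.F ρ X := by
  have := frobInner_le_mul_lamMax (h.posSemidef hW) hX.neg (h.trace_le hW)
  rw [frobInner_neg_right] at this
  rw [SDP.F]
  linarith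

/-- `W` is an exact weight at `X`: the linear function `⟨C - W, ·⟩` touches `F` at `X`. -/
def SDP.IsExactWeight (ρ : ℝ) (X W : Matrix (Fin n) (Fin n) ℝ) : Prop :=
  ‖W‖ ≤ ρ ∧ D.F ρ X = frobInner D.C X - frobInner W X

end Model

section Update

variable {n rp rc : ℕ} {X Wbar Wbar' : Matrix (Fin n) (Fin n) ℝ}
  {P P' : Matrix (Fin n) (Fin (rp + rc)) ℝ} {γ : ℝ}
  {S : Matrix (Fin (rp + rc)) (Fin (rp + rc)) ℝ}

lemma IsEigDecomp.eq_add {Q : Matrix (Fin (rp + rc)) (Fin (rp + rc)) ℝ} {d : Fin (rp + rc) → ℝ}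
    (h : IsEigDecomp S Q d) :
    S = Q.submatrix id (Fin.castAdd rc) * Matrix.diagonal (fun i => d (Fin.castAdd rc i)) *
        (Q.submatrix id (Fin.castAdd rc))ᵀ +
      Q.submatrix id (Fin.natAdd rp) * Matrix.diagonal (fun i => d (Fin.natAdd rp i)) *
        (Q.submatrix id (Fin.natAdd rp))ᵀ := by
  conv_lhs => rw [h.2.2]
  ext i j
  simp [Matrix.mul_apply, Matrix.diagonal_apply, Fin.sum_univ_add]

/-- The updated model is admissible, still contains the previous aggregate weight `W`, and contains
an exact weight at the candidate `X`. -/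
lemma ModelUpdate.spec (hrc : 1 ≤ rc) (h : ModelUpdate X Wbar P γ S Wbar' P')
    (hWP : IsAdmissible Wbar P) (hγ : 0 ≤ γ) (hS : S.PosSemidef) {ρ : ℝ} (hρ : 0 < ρ)
    (hle : γ + S.trace ≤ ρ) :
    IsAdmissible Wbar' P' ∧ γ • Wbar + P * S * Pᵀ ∈ weightSet ρ Wbar' P' ∧
      ∀ {m : ℕ} (D : SDP n m), ∃ G ∈ weightSet ρ Wbar' P', D.IsExactWeight ρ X G := by
  obtain ⟨V, Q, d, hV, hQ, hP', hVB, hQB, hne, hzero⟩ := h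
  -- The coefficient matrices in `ModelUpdate` elaborate as `CStarMatrix`, a synonym of `Matrix`.
  obtain ⟨B₀, hB₀⟩ : ∃ B : Matrix (Fin (rp + rc)) (Fin rc) ℝ, V = P' * B := hVB
  obtain ⟨B, hB⟩ : ∃ B : Matrix (Fin (rp + rc)) (Fin rp) ℝ,
      P * Q.submatrix id (Fin.castAdd rc) = P' * B := hQB
  set Q₁ : Matrix (Fin (rp + rc)) (Fin rp) ℝ := Q.submatrix id (Fin.castAdd rc) with hQ₁
  set Q₂ : Matrix (Fin (rp + rc)) (Fin rc) ℝ := Q.submatrix id (Fin.natAdd rp) with hQ₂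
  set T₁ : Matrix (Fin rp) (Fin rp) ℝ :=
    Matrix.diagonal (fun i => d (Fin.castAdd rc i)) with hT₁
  set T₂ : Matrix (Fin rc) (Fin rc) ℝ :=
    Matrix.diagonal (fun i => d (Fin.natAdd rp i)) with hT₂
  have hd := hQ.nonneg hS
  have hT₁p : T₁.PosSemidef := Matrix.PosSemidef.diagonal fun i => hd _
  have hT₂p : T₂.PosSemidef := Matrix.PosSemidef.diagonal fun i => hd _
  have hSeq : S = Q₁ * T₁ * Q₁ᵀ + Q₂ * T₂ * Q₂ᵀ := hQ.eq_add
  have hQ₁o : Q₁ᵀ * Q₁ = 1 := transpose_mul_submatrix hQ.1 (Fin.castAdd_injective _ _)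
  have hQ₂o : Q₂ᵀ * Q₂ = 1 := transpose_mul_submatrix hQ.1 (Fin.natAdd_injective _ _)
  have htr : S.trace = T₁.trace + T₂.trace := by
    rw [hSeq, Matrix.trace_add, trace_mul_mul_transpose hQ₁o, trace_mul_mul_transpose hQ₂o]
  have hPo : ∀ {k : ℕ} {U : Matrix (Fin (rp + rc)) (Fin k) ℝ}, Uᵀ * U = 1 →
      (P * U)ᵀ * (P * U) = 1 := fun {k U} hU => by
    rw [Matrix.transpose_mul, Matrix.mul_assoc, ← Matrix.mul_assoc Pᵀ, hWP.2.2, Matrix.one_mul, hU]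
  have hBB : Bᵀ * B = 1 := by
    have h1 := hPo hQ₁o
    rwa [hB, Matrix.transpose_mul, Matrix.mul_assoc, ← Matrix.mul_assoc P'ᵀ, hP',
      Matrix.one_mul] at h1
  have hT₂0 := hT₂p.trace_nonneg
  set R₂ := γ • Wbar + P * Q₂ * T₂ * Q₂ᵀ * Pᵀ with hR₂
  have hR₂' : R₂ = γ • Wbar + (P * Q₂) * T₂ * (P * Q₂)ᵀ := by
    rw [hR₂, Matrix.transpose_mul]
    simp only [Matrix.mul_assoc]
  have hR₂p : R₂.PosSemidef := by
    rw [hR₂']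
    exact (hWP.1.smul hγ).add (posSemidef_mul_mul_transpose _ hT₂p)
  have hR₂t : R₂.trace = γ + T₂.trace := by
    rw [hR₂', Matrix.trace_add, Matrix.trace_smul, hWP.2.1, trace_mul_mul_transpose (hPo hQ₂o),
      smul_eq_mul, mul_one]
  have hadm : IsAdmissible Wbar' P' := by
    by_cases h0 : γ + T₂.trace = 0
    · exact ⟨(hzero h0).1, (hzero h0).2, hP'⟩
    · refine ⟨?_, ?_, hP'⟩
      · rw [hne h0]
        exact hR₂p.smul (inv_nonneg.2 (by positivity))
      · rw [hne h0, Matrix.trace_smul, hR₂t, smul_eq_mul, inv_mul_cancel₀ h0]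
  refine ⟨hadm, ⟨γ + T₂.trace, B * T₁ * Bᵀ, by positivity, posSemidef_mul_mul_transpose _ hT₁p, ?_,
    ?_⟩, fun D => ?_⟩
  · rw [trace_mul_mul_transpose hBB]
    linarith
  · -- The retained past information is `R₂`; it vanishes when its trace does.
    have hR₂W : R₂ = (γ + T₂.trace) • Wbar' := by
      by_cases h0 : γ + T₂.trace = 0
      · rw [h0, zero_smul, ← hR₂p.trace_eq_zero_iff, hR₂t, h0]
      · rw [hne h0, smul_smul, mul_inv_cancel₀ h0, one_smul]
    have h1 : P' * (B * T₁ * Bᵀ) * P'ᵀ = (P * Q₁) * T₁ * (P * Q₁)ᵀ := by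
      rw [hB, Matrix.transpose_mul]
      simp only [Matrix.mul_assoc]
    rw [← hR₂W, h1, hR₂', hSeq, Matrix.mul_add, Matrix.add_mul, Matrix.transpose_mul,
      Matrix.transpose_mul]
    simp only [Matrix.mul_assoc]
    abel
  · rcases le_total (lamMax (-X)) 0 with h0 | h0
    · refine ⟨0, zero_mem_weightSet hρ.le, by simpa using hρ.le, ?_⟩
      rw [SDP.F, max_eq_right h0, frobInner_zero_left]
      ring
    · obtain ⟨v, ⟨e, he⟩, hv1, hvX⟩ := hV.exists_col (by omega)
      rw [hB₀, ← Matrix.mulVec_mulVec] at he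
      generalize B₀ *ᵥ e = u at he
      have huu : u ⬝ᵥ u = 1 := by
        rw [← hv1, he, Matrix.dotProduct_mulVec, Matrix.vecMul_mulVec, hP',
          Matrix.vecMul_one]
      have hmem : Matrix.vecMulVec v v ∈ weightSet 1 Wbar' P' := by
        refine ⟨0, Matrix.vecMulVec u u, le_rfl,
          by simpa using Matrix.posSemidef_vecMulVec_self_star u, ?_, ?_⟩
        · rw [Matrix.trace_vecMulVec, huu, zero_add]
        · rw [zero_smul, zero_add, Matrix.mul_vecMulVec, Matrix.vecMulVec_mul,
            Matrix.vecMul_transpose, he]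
      have hmem' : ρ • Matrix.vecMulVec v v ∈ weightSet ρ Wbar' P' := by
        simpa using smul_mem_weightSet hρ.le hmem
      refine ⟨_, hmem', hadm.norm_le hmem', ?_⟩
      rw [SDP.F, max_eq_left h0, ← hvX, frobInner_smul_left, frobInner_mulVec_self,
        Matrix.neg_mulVec, dotProduct_neg]
      ring

end Update

/-! ### The master problem -/

section Master

variable {n m r : ℕ} {D : SDP n m} {ρ α : ℝ} {Wbar Ω X W : Matrix (Fin n) (Fin n) ℝ}
  {P : Matrix (Fin n) (Fin r) ℝ} {y : Fin m → ℝ}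

/-- First-order optimality conditions of the dual form of the master problem, at the primal point
`X = Ω + (W - C + 𝒜*(y)) / α` that it determines. -/
lemma masterDual_optimality (hα : 0 < α) (hW : W ∈ weightSet ρ Wbar P)
    (hmin : IsMinOn (D.masterDualObj α Ω) (weightSet ρ Wbar P ×ˢ Set.univ) (W, y))
    (hX : α • (X - Ω) = W - D.C + D.Aadj y) :
    D.Amap X = D.b ∧ ∀ V ∈ weightSet ρ Wbar P, frobInner W X ≤ frobInner V X := by
  have key : ∀ V ∈ weightSet ρ Wbar P, ∀ z : Fin m → ℝ,
      0 ≤ frobInner (V - W) X - (D.b - D.Amap X) ⬝ᵥ z := by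
    intro V hV z
    set a := frobInner (V - W) X - (D.b - D.Amap X) ⬝ᵥ z with ha
    set H := V - W + D.Aadj z with hH
    have hexp : ∀ s : ℝ, 0 ≤ s → s ≤ 1 → 0 ≤ s * a + s ^ 2 * (1 / (2 * α) * frobSq H) := by
      intro s hs0 hs1
      have hmem : W + s • (V - W) ∈ weightSet ρ Wbar P := by
        have := convex_weightSet ρ hW hV (sub_nonneg.2 hs1) hs0 (by ring)
        convert this using 1
        module
      have h1 := hmin (a := (W + s • (V - W), y + s • z)) ⟨hmem, trivial⟩
      simp only [Set.mem_ofPred_eq, SDP.masterDualObj] at h1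
      have h2 : W + s • (V - W) - D.C + D.Aadj (y + s • z) = α • (X - Ω) + s • H := by
        rw [hX, D.Aadj_add, D.Aadj_smul, hH]
        module
      have h3 : frobSq (α • (X - Ω) + s • H) = frobSq (α • (X - Ω))
          + 2 * s * α * frobInner H (X - Ω) + s ^ 2 * frobSq H := by
        simp only [frobSq, frobInner_add_left, frobInner_add_right, frobInner_smul_left,
          frobInner_smul_right, frobInner_comm (X - Ω) H]
        ring
      have h4 : frobInner H (X - Ω) = frobInner (V - W) X - frobInner (V - W) Ω
          + D.Amap X ⬝ᵥ z - D.Amap Ω ⬝ᵥ z := by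
        rw [hH, frobInner_add_left, D.frobInner_Aadj, D.Amap_sub, frobInner_sub_right,
          sub_dotProduct]
        ring
      rw [h2, h3, ← hX] at h1
      have h5 : frobInner (W + s • (V - W) - D.C) Ω = frobInner (W - D.C) Ω
          + s * frobInner (V - W) Ω := by
        simp only [frobInner_add_left, frobInner_sub_left, frobInner_smul_left]
        ring
      rw [h5, dotProduct_add, dotProduct_smul, smul_eq_mul, sub_dotProduct _ _ z] at h1
      have h6 : 1 / (2 * α) * (2 * s * α * frobInner H (X - Ω)) = s * frobInner H (X - Ω) := by
        field_simp
      rw [mul_add, mul_add, h6, h4] at h1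
      rw [ha, sub_dotProduct]
      linarith
    -- A linear term dominating a quadratic one near zero is nonnegative.
    by_contra! hneg
    set q := 1 / (2 * α) * frobSq H with hq
    have hq0 : 0 ≤ q := mul_nonneg (by positivity) (frobSq_nonneg H)
    have hs0 : 0 < -a / (q + -a) := div_pos (by linarith) (by linarith)
    have hs1 : -a / (q + -a) ≤ 1 := by rw [div_le_one (by linarith)]; linarith
    have h1 := hexp _ hs0.le hs1
    set s := -a / (q + -a)
    have h2 : s * (q + -a) = -a := div_mul_cancel₀ _ (by linarith)
    nlinarith [mul_pos hs0 hs0]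
  have hA : D.Amap X = D.b := by
    have h1 := key W hW (D.b - D.Amap X)
    rw [sub_self, frobInner_zero_left, zero_sub] at h1
    have h2 : (D.b - D.Amap X) ⬝ᵥ (D.b - D.Amap X) = 0 :=
      le_antisymm (by linarith) (SDP.dotProduct_self_nonneg' _)
    exact (sub_eq_zero.1 (dotProduct_self_eq_zero.1 h2)).symm
  refine ⟨hA, fun V hV => ?_⟩
  have h1 := key V hV 0
  rw [dotProduct_zero, sub_zero, frobInner_sub_left] at h1
  linarith

/-- The consequences of solving the master problem at the reference point `Ω` that the analysis
uses: `W` is the aggregate weight, `⟨C - W, ·⟩` minorizes the model and agrees with it at `X`, and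
`X` minimizes `⟨C - W, ·⟩ + α/2 ‖· - Ω‖²` on the affine set. -/
structure MasterSolution (D : SDP n m) (ρ α : ℝ) (Wbar : Matrix (Fin n) (Fin n) ℝ)
    (P : Matrix (Fin n) (Fin r) ℝ) (Ω X W : Matrix (Fin n) (Fin n) ℝ) (y : Fin m → ℝ) : Prop where
  adm : IsAdmissible Wbar P
  W_mem : W ∈ weightSet ρ Wbar P
  X_mem : X ∈ D.affineSet
  grad : α • (X - Ω) = W - D.C + D.Aadj y
  model_eq : D.model ρ Wbar P X = frobInner D.C X - frobInner W X
  frobInner_W_nonpos : frobInner W X ≤ 0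
  prox : ∀ Y ∈ D.affineSet, frobInner D.C Y - frobInner W Y + α / 2 * ‖Y - Ω‖ ^ 2 =
    D.masterObj ρ α Wbar P Ω X + α / 2 * ‖Y - X‖ ^ 2

lemma norm_sub_sq_eq (Y X Ω : Matrix (Fin n) (Fin n) ℝ) :
    ‖Y - Ω‖ ^ 2 = ‖Y - X‖ ^ 2 + 2 * frobInner (X - Ω) (Y - X) + ‖X - Ω‖ ^ 2 := by
  have h : Y - Ω = (Y - X) + (X - Ω) := by abel
  rw [h, norm_sq_eq_frobSq, norm_sq_eq_frobSq, norm_sq_eq_frobSq, frobSq, frobInner_add_left,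
    frobInner_add_right, frobInner_add_right, frobInner_comm (Y - X) (X - Ω), frobSq, frobSq]
  ring

lemma masterSolution (hα : 0 < α) (hρ : 0 < ρ) (hWP : IsAdmissible Wbar P) (hΩ : Ω.IsSymm)
    (hX : X ∈ D.affineSet) (hXmin : IsMinOn (D.masterObj ρ α Wbar P Ω) D.affineSet X)
    (hW : W ∈ weightSet ρ Wbar P)
    (hmin : IsMinOn (D.masterDualObj α Ω) (weightSet ρ Wbar P ×ˢ Set.univ) (W, y)) :
    MasterSolution D ρ α Wbar P Ω X W y := by
  set X' := Ω + α⁻¹ • (W - D.C + D.Aadj y) with hX'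
  have hgrad : α • (X' - Ω) = W - D.C + D.Aadj y := by
    rw [hX', add_sub_cancel_left, smul_smul, mul_inv_cancel₀ hα.ne', one_smul]
  obtain ⟨hA, hopt⟩ := masterDual_optimality hα hW hmin hgrad
  have hX's : X' ∈ D.affineSet :=
    ⟨hΩ.add ((((hWP.posSemidef hW).isSymm'.sub D.symm_C).add (D.Aadj_isSymm y)).smul _), hA⟩
  have hmodel : D.model ρ Wbar P X' = frobInner D.C X' - frobInner W X' :=
    le_antisymm (D.model_le hρ fun V hV => by linarith [hopt V hV]) (hWP.le_model D hρ hX's.1 hW)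
  have hprox : ∀ Y ∈ D.affineSet, frobInner D.C Y - frobInner W Y + α / 2 * ‖Y - Ω‖ ^ 2 =
      D.masterObj ρ α Wbar P Ω X' + α / 2 * ‖Y - X'‖ ^ 2 := by
    intro Y hY
    have h1 : frobInner (α • (X' - Ω)) (Y - X') =
        frobInner W (Y - X') - frobInner D.C (Y - X') := by
      rw [hgrad, frobInner_add_left, D.frobInner_Aadj, D.Amap_sub, hY.2, hA, sub_self,
        zero_dotProduct, frobInner_sub_left, add_zero]
    rw [frobInner_smul_left, frobInner_sub_right W, frobInner_sub_right D.C] at h1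
    rw [SDP.masterObj, hmodel, norm_sub_sq_eq Y X' Ω, ← norm_sq_eq_frobSq]
    linarith
  have hXX : X = X' := by
    have h1 : D.masterObj ρ α Wbar P Ω X ≤ D.masterObj ρ α Wbar P Ω X' := hXmin hX's
    have h2 := hprox X hX
    have h3 := hWP.le_model D hρ hX.1 hW
    rw [SDP.masterObj, ← norm_sq_eq_frobSq] at h1
    have h4 : ‖X - X'‖ ^ 2 ≤ 0 := by
      by_contra! h5
      nlinarith [mul_pos hα h5]
    rw [← sub_eq_zero, ← norm_eq_zero]
    exact pow_eq_zero_iff two_ne_zero |>.1 (le_antisymm h4 (by positivity))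
  rw [hXX]
  refine ⟨hWP, hW, hX's, hgrad, hmodel, ?_, hprox⟩
  simpa [frobInner_zero_left] using hopt 0 (zero_mem_weightSet hρ.le)

namespace MasterSolution

variable (h : MasterSolution D ρ α Wbar P Ω X W y)
include h

lemma masterObj_eq :
    D.masterObj ρ α Wbar P Ω X = frobInner D.C X - frobInner W X + α / 2 * ‖X - Ω‖ ^ 2 := by
  rw [SDP.masterObj, h.model_eq, norm_sq_eq_frobSq]

/-- The predicted decrease `F(Ω) - masterObj(X)` controls the length of the step. -/
lemma step_sq_le (hΩ : Ω ∈ D.affineSet) :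
    α / 2 * ‖X - Ω‖ ^ 2 ≤ D.F ρ Ω - D.masterObj ρ α Wbar P Ω X := by
  have h1 := h.prox Ω hΩ
  have h2 := h.adm.sub_le_F D hΩ.1 h.W_mem
  rw [sub_self, norm_zero, norm_sub_rev Ω X] at h1
  linarith

/-- The predicted decrease compares the reference point with any other point `Y`, along the
segment joining them. -/
lemma le_predicted (hα : 0 < α) (hΩ : Ω ∈ D.affineSet) {Y : Matrix (Fin n) (Fin n) ℝ}
    (hY : Y ∈ D.affineSet) {s : ℝ} (hs0 : 0 ≤ s) (hs1 : s ≤ 1) :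
    s * (D.F ρ Ω - D.F ρ Y) - α / 2 * s ^ 2 * ‖Ω - Y‖ ^ 2 ≤
      D.F ρ Ω - D.masterObj ρ α Wbar P Ω X := by
  set Z := (1 - s) • Ω + s • Y with hZ
  have hZs : Z ∈ D.affineSet := by
    refine ⟨(hΩ.1.smul _).add (hY.1.smul _), ?_⟩
    rw [hZ, D.Amap_add, D.Amap_smul, D.Amap_smul, hΩ.2, hY.2, ← add_smul, sub_add_cancel, one_smul]
  have h1 := h.prox Z hZs
  have h2 := h.adm.sub_le_F D hΩ.1 h.W_mem
  have h3 := h.adm.sub_le_F D hY.1 h.W_mem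
  have h4 : ‖Z - Ω‖ ^ 2 = s ^ 2 * ‖Ω - Y‖ ^ 2 := by
    have : Z - Ω = -(s • (Ω - Y)) := by rw [hZ]; module
    rw [this, norm_neg, norm_smul, mul_pow, Real.norm_of_nonneg hs0]
  rw [h4, hZ] at h1
  simp only [frobInner_add_right, frobInner_smul_right] at h1
  have h5 : 0 ≤ α / 2 * ‖(1 - s) • Ω + s • Y - X‖ ^ 2 := by positivity
  have h6 := mul_le_mul_of_nonneg_left h2 (sub_nonneg.2 hs1)
  have h7 := mul_le_mul_of_nonneg_left h3 hs0
  linarith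

lemma predicted_le (hα : 0 < α) :
    D.F ρ Ω - D.masterObj ρ α Wbar P Ω X ≤
      ρ * max (lamMax (-Ω)) 0 + ‖D.C‖ ^ 2 / (2 * α) := by
  have h1 := h.frobInner_W_nonpos
  have h2 := (abs_le.1 (abs_frobInner_le D.C (X - Ω))).1
  rw [frobInner_sub_right] at h2
  rw [h.masterObj_eq, SDP.F]
  have h3 : ‖D.C‖ * ‖X - Ω‖ ≤ ‖D.C‖ ^ 2 / (2 * α) + α / 2 * ‖X - Ω‖ ^ 2 := by
    have : ‖D.C‖ ^ 2 / (2 * α) + α / 2 * ‖X - Ω‖ ^ 2 - ‖D.C‖ * ‖X - Ω‖ =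
        (‖D.C‖ - α * ‖X - Ω‖) ^ 2 / (2 * α) := by
      field_simp
      ring
    have h4 : 0 ≤ (‖D.C‖ - α * ‖X - Ω‖) ^ 2 / (2 * α) := by positivity
    linarith
  linarith

/-- Distance of the candidate to an arbitrary feasible point. -/
lemma norm_sub_le (hα : 0 < α) (hρ : 0 ≤ ρ) {Y : Matrix (Fin n) (Fin n) ℝ}
    (hY : Y ∈ D.affineSet) :
    ‖Y - X‖ ≤ 2 / α * (‖D.C‖ + ρ) + ‖Y - Ω‖ ^ 2 + 1 := by
  have h1 := h.prox Y hY
  rw [h.masterObj_eq] at h1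
  have h2 := (abs_le.1 (abs_frobInner_le D.C (Y - X))).2
  have h3 := (abs_le.1 (abs_frobInner_le W (Y - X))).1
  rw [frobInner_sub_right] at h2 h3
  have h4 : ‖W‖ * ‖Y - X‖ ≤ ρ * ‖Y - X‖ := by
    gcongr
    exact h.adm.norm_le h.W_mem
  have h5 : α / 2 * ‖Y - X‖ ^ 2 ≤ (‖D.C‖ + ρ) * ‖Y - X‖ + α / 2 * ‖Y - Ω‖ ^ 2 := by
    nlinarith [sq_nonneg ‖X - Ω‖]
  have h6 : ‖Y - X‖ ^ 2 ≤ 2 / α * (‖D.C‖ + ρ) * ‖Y - X‖ + ‖Y - Ω‖ ^ 2 := by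
    have := mul_le_mul_of_nonneg_left h5 (by positivity : (0 : ℝ) ≤ 2 / α)
    calc ‖Y - X‖ ^ 2 = 2 / α * (α / 2 * ‖Y - X‖ ^ 2) := by field_simp
      _ ≤ _ := this
      _ = _ := by field_simp
  have h7 : 0 ≤ 2 / α * (‖D.C‖ + ρ) := by positivity
  by_contra! h8
  nlinarith [norm_nonneg (Y - X), sq_nonneg ‖Y - Ω‖]

/-- Null-step inequality: if the next model at the same reference point retains the aggregate
weight `W` and contains an exact weight at `X`, then its optimal value increases. -/
lemma null_step {Wbar' X' W' : Matrix (Fin n) (Fin n) ℝ} {P' : Matrix (Fin n) (Fin r) ℝ}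
    {y' : Fin m → ℝ} (hα : 0 < α) (hρ : 0 < ρ) (h' : MasterSolution D ρ α Wbar' P' Ω X' W' y')
    (hW : W ∈ weightSet ρ Wbar' P')
    {G : Matrix (Fin n) (Fin n) ℝ} (hG : G ∈ weightSet ρ Wbar' P') (hGX : D.IsExactWeight ρ X G) :
    α / 2 * ‖X' - X‖ ^ 2 ≤ D.masterObj ρ α Wbar' P' Ω X' - D.masterObj ρ α Wbar P Ω X ∧
    D.F ρ X - D.model ρ Wbar P X - 2 * ρ * ‖X' - X‖ ≤
      D.masterObj ρ α Wbar' P' Ω X' - D.masterObj ρ α Wbar P Ω X := by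
  have h1 := h.prox X' h'.X_mem
  have h2 := h'.adm.le_model D hρ h'.X_mem.1 hW
  have h3 := h'.adm.le_model D hρ h'.X_mem.1 hG
  have h4 : D.masterObj ρ α Wbar' P' Ω X' = D.model ρ Wbar' P' X' + α / 2 * ‖X' - Ω‖ ^ 2 := by
    rw [SDP.masterObj, norm_sq_eq_frobSq]
  refine ⟨by linarith, ?_⟩
  have h5 := (abs_le.1 (abs_frobInner_le (W - G) (X' - X))).1
  have h6 : ‖W - G‖ * ‖X' - X‖ ≤ 2 * ρ * ‖X' - X‖ := by
    gcongr
    refine (_root_.norm_sub_le _ _).trans ?_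
    linarith [h.adm.norm_le h.W_mem, hGX.1]
  simp only [frobInner_sub_left, frobInner_sub_right] at h5
  have h7 : 0 ≤ α / 2 * ‖X' - X‖ ^ 2 := by positivity
  rw [hGX.2, h.model_eq]
  linarith

/-- The duality gap of the dual iterate in terms of the step length and of the primal
infeasibility of the reference point. -/
lemma abs_gap_le (hα : 0 < α) (hρ : 0 < ρ) (hΩ : Ω ∈ D.affineSet) :
    |frobInner D.C Ω - D.b ⬝ᵥ y| ≤
      (α * ‖Ω‖ + ρ + ‖D.C‖) * ‖X - Ω‖ + (ρ * max (lamMax (-Ω)) 0) := by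
  have h0 := h.step_sq_le hΩ
  rw [h.masterObj_eq, SDP.F] at h0
  have hy : D.b ⬝ᵥ y = frobInner (D.Aadj y) Ω := by rw [D.frobInner_Aadj, hΩ.2]
  have hAy : D.Aadj y = α • (X - Ω) - W + D.C := by rw [h.grad]; abel
  have h1 : frobInner D.C Ω - D.b ⬝ᵥ y = frobInner W Ω - α * frobInner (X - Ω) Ω := by
    rw [hy, hAy, frobInner_add_left, frobInner_sub_left, frobInner_smul_left]
    ring
  have h2 := abs_le.1 (abs_frobInner_le (X - Ω) Ω)
  have h3 := abs_le.1 (abs_frobInner_le W (X - Ω))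
  have h4 := abs_le.1 (abs_frobInner_le D.C (X - Ω))
  have h5 : ‖W‖ * ‖X - Ω‖ ≤ ρ * ‖X - Ω‖ := by
    gcongr
    exact h.adm.norm_le h.W_mem
  rw [frobInner_sub_right] at h3 h4
  have h6 := h.frobInner_W_nonpos
  have h7 := norm_nonneg (X - Ω)
  have h8 : 0 ≤ ρ * max (lamMax (-Ω)) 0 := mul_nonneg hρ.le (le_max_right _ _)
  have h9 : 0 ≤ ‖D.C‖ * ‖X - Ω‖ := by positivity
  have h10 := mul_le_mul_of_nonneg_left h2.1 hα.le
  have h11 := mul_le_mul_of_nonneg_left h2.2 hα.le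
  rw [h1, abs_le]
  constructor <;> nlinarith

end MasterSolution

end Master

/-! ### Counting iterations -/

section Counting

variable {β c M w η : ℝ} {δ v : ℕ → ℝ}

/-- While the cost gap `δ` exceeds `η` and the predicted decrease satisfies `v ≥ w δ`, the
potential `1 / (c v) + B / δ`, with `B = (1 / (c w) + M) / (β w)`, grows by at least one per
iteration. A null step raises the first term by one; a descent step may reset the first term, of
size at most `1 / (c w δ)`, but raises the second one by at least `(1 / (c w) + M) / δ`. -/
lemma natCast_le_potential (hβ : 0 < β) (hc : 0 < c) (hM : 0 ≤ M) (hw : 0 < w) (hη : 0 < η)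
    (hδM : ∀ t, δ t ≤ M) (hv : ∀ t, 0 ≤ v t)
    (hstep : ∀ t, (δ (t + 1) = δ t ∧ v (t + 1) ≤ v t - c * v t ^ 2) ∨
      δ (t + 1) ≤ δ t - β * v t)
    (hwv : ∀ t, η < δ t → w * δ t ≤ v t) (T : ℕ) (hT : ∀ t ≤ T, η < δ t) :
    (T : ℝ) ≤ 1 / (c * v T) + (1 / (c * w) + M) / (β * w) / δ T := by
  have hB : 0 ≤ (1 / (c * w) + M) / (β * w) := by positivity
  induction T with
  | zero =>
    have h1 : 0 < δ 0 := hη.trans (hT 0 le_rfl)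
    have h2 := hv 0
    simp only [Nat.cast_zero]
    positivity
  | succ T ih =>
    specialize ih fun t ht => hT t (by omega)
    have hδ := hη.trans (hT T (by omega))
    have hδ' := hη.trans (hT (T + 1) le_rfl)
    have hvT := (mul_pos hw hδ).trans_le (hwv T (hT T (by omega)))
    have hvT' := (mul_pos hw hδ').trans_le (hwv (T + 1) (hT (T + 1) le_rfl))
    push_cast
    rcases hstep T with ⟨h1, h2⟩ | h1
    · have h3 : 1 / (c * v T) + 1 ≤ 1 / (c * v (T + 1)) := by
        rw [div_add_one (by positivity), div_le_div_iff₀ (by positivity) (by positivity)]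
        have h4 : v (T + 1) * (1 + c * v T) ≤ (v T - c * v T ^ 2) * (1 + c * v T) := by gcongr
        have h5 : 0 ≤ c ^ 2 * v T ^ 3 := by positivity
        nlinarith
      rw [h1]
      linarith
    · set B := (1 / (c * w) + M) / (β * w) with hBdef
      have h2 : w * δ T ≤ v T := hwv T (hT T (by omega))
      have h3 : B / δ T + (1 / (c * w) + M) / δ T ≤ B / δ (T + 1) := by
        have h4 : δ (T + 1) * (1 + β * w) ≤ δ T := by
          have h5 : δ (T + 1) ≤ δ T * (1 - β * w) := by nlinarith
          have h6 : 0 ≤ δ T * (β * w) ^ 2 := by positivity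
          nlinarith [mul_le_mul_of_nonneg_right h5 (by positivity : 0 ≤ 1 + β * w)]
        have h5 : 1 / (c * w) + M = B * (β * w) := by rw [hBdef]; field_simp
        rw [h5, ← add_div, div_le_div_iff₀ hδ hδ']
        nlinarith
      have h6 : 1 / (c * v T) ≤ 1 / (c * w) / δ T := by
        rw [div_div, mul_assoc]
        gcongr
      have h7 : 1 ≤ M / δ T := by rw [one_le_div hδ]; exact hδM T
      have h8 : 0 ≤ 1 / (c * v (T + 1)) := by positivity
      rw [add_div] at h3
      linarith

/-- Once the cost gap `δ` is at most `η`, a descent step can only happen when `β v ≤ η`, and null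
steps alone drive `v` down to this level. -/
lemma natCast_le_inv (hβ : 0 < β) (hc : 0 < c) (hη : 0 < η) (hδ : ∀ t, 0 ≤ δ t)
    (hstep : ∀ t, (δ (t + 1) = δ t ∧ v (t + 1) ≤ v t - c * v t ^ 2) ∨
      δ (t + 1) ≤ δ t - β * v t)
    (hδη : ∀ t, δ t ≤ η) (T : ℕ) (hT : ∀ t ≤ T, η < β * v t) :
    (T : ℝ) ≤ 1 / (c * v T) := by
  have hpos : ∀ t ≤ T, 0 < v t := fun t ht => pos_of_mul_pos_right (hη.trans (hT t ht)) hβ.le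
  induction T with
  | zero =>
    have := hpos 0 le_rfl
    simp only [Nat.cast_zero]
    positivity
  | succ T ih =>
    specialize ih (fun t ht => hT t (by omega)) (fun t ht => hpos t (by omega))
    have hvT := hpos T (by omega)
    have hvT' := hpos (T + 1) le_rfl
    push_cast
    rcases hstep T with ⟨-, h2⟩ | h1
    · refine (add_le_add_left ih 1).trans ?_
      rw [div_add_one (by positivity), div_le_div_iff₀ (by positivity) (by positivity)]
      have h4 : v (T + 1) * (1 + c * v T) ≤ (v T - c * v T ^ 2) * (1 + c * v T) := by gcongr
      have h5 : 0 ≤ c ^ 2 * v T ^ 3 := by positivity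
      nlinarith
    · linarith [hT T (by omega), hδ (T + 1), hδη T]

/-- The iteration count: if `v ≥ w δ` as long as `δ > η`, then `O(1 / (η w²))` iterations suffice
to make both `δ` and `β v` at most `η`. -/
lemma exists_iteration_le (hβ : 0 < β) (hc : 0 < c) (hM : 0 ≤ M) :
    ∃ K : ℝ, 0 ≤ K ∧ ∀ δ v : ℕ → ℝ, (∀ t, 0 ≤ δ t) → (∀ t, δ t ≤ M) → (∀ t, 0 ≤ v t) →
      (∀ t, (δ (t + 1) = δ t ∧ v (t + 1) ≤ v t - c * v t ^ 2) ∨ δ (t + 1) ≤ δ t - β * v t) →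
      ∀ η w : ℝ, 0 < η → η ≤ 1 → 0 < w → w ≤ 1 → (∀ t, η < δ t → w * δ t ≤ v t) →
        ∃ t : ℕ, (t : ℝ) ≤ K / (η * w ^ 2) ∧ δ t ≤ η ∧ β * v t ≤ η := by
  refine ⟨1 / c + (1 / c + M) / β + β / c + 2, by positivity,
    fun δ v hδ hδM hv hstep η w hη hη1 hw hw1 hwv => ?_⟩
  have hw2 : w ^ 2 ≤ w := by nlinarith
  -- First phase: reach cost gap `η`.
  set K₁ := 1 / c / (η * w ^ 2) + (1 / c + M) / β / (η * w ^ 2) with hK₁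
  have hK₁0 : 0 ≤ K₁ := by positivity
  obtain ⟨t₁, ht₁, hδ₁⟩ : ∃ t₁ : ℕ, (t₁ : ℝ) ≤ K₁ + 1 ∧ δ t₁ ≤ η := by
    by_contra! hcon
    have hall : ∀ t ≤ ⌊K₁⌋₊ + 1, η < δ t := fun t ht => by
      refine hcon t ?_
      have h1 : (t : ℝ) ≤ ⌊K₁⌋₊ + 1 := by exact_mod_cast ht
      linarith [Nat.floor_le hK₁0]
    have h1 := natCast_le_potential hβ hc hM hw hη hδM hv hstep hwv _ hall
    set T := ⌊K₁⌋₊ + 1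
    have hT := hall T le_rfl
    have hT0 : 0 ≤ δ T := hδ T
    have h2 : 1 / (c * v T) ≤ 1 / c / (η * w ^ 2) := by
      rw [div_div]
      gcongr
      calc η * w ^ 2 ≤ δ T * w := by gcongr
        _ ≤ v T := by rw [mul_comm]; exact hwv T hT
    have h3 : (1 / (c * w) + M) / (β * w) / δ T ≤ (1 / c + M) / β / (η * w ^ 2) := by
      have h4 : 1 / (c * w) + M ≤ (1 / c + M) / w := by
        rw [add_div, div_div]
        gcongr
        rw [le_div_iff₀ hw]
        nlinarith
      calc (1 / (c * w) + M) / (β * w) / δ T ≤ (1 / c + M) / w / (β * w) / η := by gcongr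
        _ = _ := by field_simp
    have h5 : K₁ < (T : ℕ) := by
      push_cast [T]
      exact Nat.lt_floor_add_one K₁
    linarith
  have hanti : ∀ s, δ (t₁ + s) ≤ η := by
    intro s
    induction s with
    | zero => exact hδ₁
    | succ s ih =>
      rw [← add_assoc]
      rcases hstep (t₁ + s) with ⟨h1, -⟩ | h1
      · rwa [h1]
      · have := mul_nonneg hβ.le (hv (t₁ + s))
        linarith
  -- Second phase: reach predicted decrease `η / β`.
  set K₂ := β / c / (η * w ^ 2) with hK₂
  have hK₂0 : 0 ≤ K₂ := by positivity
  obtain ⟨s, hs, hvs⟩ : ∃ s : ℕ, (s : ℝ) ≤ K₂ + 1 ∧ β * v (t₁ + s) ≤ η := by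
    by_contra! hcon
    have hall : ∀ s ≤ ⌊K₂⌋₊ + 1, η < β * v (t₁ + s) := fun s hs => by
      refine hcon s ?_
      have h1 : (s : ℝ) ≤ ⌊K₂⌋₊ + 1 := by exact_mod_cast hs
      linarith [Nat.floor_le hK₂0]
    have h1 := natCast_le_inv (δ := fun s => δ (t₁ + s)) (v := fun s => v (t₁ + s)) hβ hc hη
      (fun s => hδ _) (fun s => hstep (t₁ + s)) hanti _ hall
    set T := ⌊K₂⌋₊ + 1
    have h2 : 1 / (c * v (t₁ + T)) ≤ β / c / η := by
      have h3 := hall T le_rfl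
      have h4 : 0 < v (t₁ + T) := pos_of_mul_pos_right (hη.trans h3) hβ.le
      rw [div_div, div_le_div_iff₀ (by positivity) (by positivity)]
      nlinarith
    have h5 : β / c / η ≤ K₂ := by
      rw [hK₂]
      gcongr
      nlinarith
    have h6 : K₂ < (T : ℕ) := by
      push_cast [T]
      exact Nat.lt_floor_add_one K₂
    linarith
  refine ⟨t₁ + s, ?_, hanti s, hvs⟩
  have h7 : 2 ≤ 2 / (η * w ^ 2) := by
    rw [le_div_iff₀ (by positivity)]
    nlinarith [mul_le_mul hη1 (hw2.trans hw1) (by positivity) zero_le_one]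
  push_cast
  calc (t₁ : ℝ) + s ≤ K₁ + K₂ + 2 / (η * w ^ 2) := by linarith
    _ = _ := by rw [hK₁, hK₂]; ring

end Counting

/-! ### Runs of the method -/

section Run

variable {n m rp rc : ℕ} {D : SDP n m} {ρ α β : ℝ} {Ω₀ : Matrix (Fin n) (Fin n) ℝ}
  {s : Iterates n m rp rc}

/-- The decrease predicted at iteration `t`: the value of `F` at the reference point minus the
optimal value of the regularized master problem. -/
noncomputable def Iterates.predicted (s : Iterates n m rp rc) (D : SDP n m) (ρ α : ℝ) (t : ℕ) : ℝ :=
  D.F ρ (s.Ω t) - D.masterObj ρ α (s.Wbar t) (s.P t) (s.Ω t) (s.X t)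

namespace IsRun

lemma admissible (h : IsRun D ρ α β Ω₀ s) (hrc : 1 ≤ rc) (hρ : 0 < ρ) (t : ℕ) :
    IsAdmissible (s.Wbar t) (s.P t) := by
  induction t with
  | zero => exact ⟨h.init_Wbar.1, h.init_Wbar.2, h.init_P.transpose_mul_self⟩
  | succ t ih =>
    exact ((h.step_model t).spec hrc ih (h.γ_nonneg t) (h.S_psd t) hρ (h.γS_le t)).1

lemma Ω_succ_mem (h : IsRun D ρ α β Ω₀ s) (hΩ₀ : Ω₀.IsSymm) (t : ℕ) :
    s.Ω (t + 1) ∈ D.affineSet := by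
  by_cases hacc : D.Accepts ρ β s t
  · rw [h.step_accept t hacc]
    exact h.X_mem t
  · rw [h.step_null t hacc]
    induction t with
    | zero =>
      refine ⟨by rwa [h.init_Ω], ?_⟩
      by_contra hne
      exact hacc (Or.inl ⟨rfl, hne⟩)
    | succ t ih =>
      by_cases hacc' : D.Accepts ρ β s t
      · rw [h.step_accept t hacc']
        exact h.X_mem t
      · rw [h.step_null t hacc']
        exact ih hacc'

lemma isSymm_Ω (h : IsRun D ρ α β Ω₀ s) (hΩ₀ : Ω₀.IsSymm) (t : ℕ) : (s.Ω t).IsSymm := by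
  cases t with
  | zero => rwa [h.init_Ω]
  | succ t => exact (h.Ω_succ_mem hΩ₀ t).1

lemma master (h : IsRun D ρ α β Ω₀ s) (hrc : 1 ≤ rc) (hα : 0 < α) (hρ : 0 < ρ)
    (hΩ₀ : Ω₀.IsSymm) (t : ℕ) :
    MasterSolution D ρ α (s.Wbar t) (s.P t) (s.Ω t) (s.X t) (s.W t) (s.y t) :=
  masterSolution hα hρ (h.admissible hrc hρ t) (h.isSymm_Ω hΩ₀ t) (h.X_mem t) (h.X_min t)
    ⟨s.γ t, s.S t, h.γ_nonneg t, h.S_psd t, h.γS_le t, rfl⟩ (h.Wy_min t)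

lemma W_mem_next (h : IsRun D ρ α β Ω₀ s) (hrc : 1 ≤ rc) (hρ : 0 < ρ) (t : ℕ) :
    s.W t ∈ weightSet ρ (s.Wbar (t + 1)) (s.P (t + 1)) :=
  ((h.step_model t).spec hrc (h.admissible hrc hρ t) (h.γ_nonneg t) (h.S_psd t) hρ
    (h.γS_le t)).2.1

lemma exists_exactWeight (h : IsRun D ρ α β Ω₀ s) (hrc : 1 ≤ rc) (hρ : 0 < ρ) (t : ℕ) :
    ∃ G ∈ weightSet ρ (s.Wbar (t + 1)) (s.P (t + 1)), D.IsExactWeight ρ (s.X t) G :=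
  ((h.step_model t).spec hrc (h.admissible hrc hρ t) (h.γ_nonneg t) (h.S_psd t) hρ
    (h.γS_le t)).2.2 D

lemma predicted_nonneg (h : IsRun D ρ α β Ω₀ s) (hrc : 1 ≤ rc) (hα : 0 < α) (hρ : 0 < ρ)
    (hΩ₀ : Ω₀.IsSymm) {t : ℕ} (ht : s.Ω t ∈ D.affineSet) : 0 ≤ s.predicted D ρ α t :=
  le_trans (by positivity) ((h.master hrc hα hρ hΩ₀ t).step_sq_le ht)

lemma predicted_le_sub_model (h : IsRun D ρ α β Ω₀ s) (hrc : 1 ≤ rc) (hα : 0 < α) (hρ : 0 < ρ)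
    (hΩ₀ : Ω₀.IsSymm) (t : ℕ) :
    s.predicted D ρ α t ≤ D.F ρ (s.Ω t) - D.model ρ (s.Wbar t) (s.P t) (s.X t) := by
  have h1 := h.master hrc hα hρ hΩ₀ t
  have h2 : 0 ≤ α / 2 * ‖s.X t - s.Ω t‖ ^ 2 := by positivity
  rw [Iterates.predicted, h1.masterObj_eq, h1.model_eq]
  linarith

/-- A descent step from a feasible reference point decreases `F` by at least `β` times the
predicted decrease. -/
lemma descent_step (h : IsRun D ρ α β Ω₀ s) (hrc : 1 ≤ rc) (hα : 0 < α) (hβ : 0 < β) (hρ : 0 < ρ)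
    (hΩ₀ : Ω₀.IsSymm) {t : ℕ} (ht : s.Ω t ∈ D.affineSet) (hacc : D.Accepts ρ β s t) :
    D.F ρ (s.Ω (t + 1)) ≤ D.F ρ (s.Ω t) - β * s.predicted D ρ α t := by
  rw [h.step_accept t hacc]
  rcases hacc with ⟨rfl, hne⟩ | hdec
  · exact absurd ht.2 hne
  · have := mul_le_mul_of_nonneg_left (h.predicted_le_sub_model hrc hα hρ hΩ₀ t) hβ.le
    linarith

/-- A null step decreases the predicted decrease `v`, bounded by `V`, by a multiple of `v²`. -/
lemma null_step (h : IsRun D ρ α β Ω₀ s) (hrc : 1 ≤ rc) (hα : 0 < α) (hβ : β ∈ Set.Ioo (0 : ℝ) 1)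
    (hρ : 0 < ρ) (hΩ₀ : Ω₀.IsSymm) {V : ℝ} (hV : 0 < V) {t : ℕ} (ht : s.Ω t ∈ D.affineSet)
    (hvV : s.predicted D ρ α t ≤ V) (hacc : ¬ D.Accepts ρ β s t) :
    s.predicted D ρ α (t + 1) ≤ s.predicted D ρ α t -
      min ((1 - β) / (2 * V)) (α * (1 - β) ^ 2 / (32 * ρ ^ 2)) * s.predicted D ρ α t ^ 2 := by
  have hΩ := h.step_null t hacc
  have h1 := h.master hrc hα hρ hΩ₀ t
  have h2 := h.master hrc hα hρ hΩ₀ (t + 1)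
  rw [hΩ] at h2
  obtain ⟨G, hG, hGX⟩ := h.exists_exactWeight hrc hρ t
  obtain ⟨h3, h4⟩ := h1.null_step hα hρ h2 (h.W_mem_next hrc hρ t) hG hGX
  have hv0 := h.predicted_nonneg hrc hα hρ hΩ₀ ht
  have h5 := h.predicted_le_sub_model hrc hα hρ hΩ₀ t
  have h6 : D.F ρ (s.Ω t) - D.F ρ (s.X t) <
      β * (D.F ρ (s.Ω t) - D.model ρ (s.Wbar t) (s.P t) (s.X t)) := by
    by_contra! h7
    exact hacc (Or.inr h7)
  have hβ1 : 0 < 1 - β := sub_pos.2 hβ.2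
  have h7 : (1 - β) * s.predicted D ρ α t ≤
      D.F ρ (s.X t) - D.model ρ (s.Wbar t) (s.P t) (s.X t) := by
    have := mul_le_mul_of_nonneg_left h5 hβ1.le
    linarith
  have h8 : s.predicted D ρ α (t + 1) = s.predicted D ρ α t -
      (D.masterObj ρ α (s.Wbar (t + 1)) (s.P (t + 1)) (s.Ω t) (s.X (t + 1)) -
        D.masterObj ρ α (s.Wbar t) (s.P t) (s.Ω t) (s.X t)) := by
    rw [Iterates.predicted, Iterates.predicted, hΩ]
    ring
  rw [h8]
  set v := s.predicted D ρ α t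
  set x := ‖s.X (t + 1) - s.X t‖
  refine sub_le_sub_left ?_ v
  -- Either the candidate moves little and the new cut is effective, or the proximal term grows.
  rcases le_total (4 * ρ * x) ((1 - β) * v) with hx | hx
  · have h9 : min ((1 - β) / (2 * V)) (α * (1 - β) ^ 2 / (32 * ρ ^ 2)) * v ^ 2 ≤
        (1 - β) / (2 * V) * v ^ 2 := by
      gcongr
      exact min_le_left _ _
    have h10 : (1 - β) / (2 * V) * v ^ 2 ≤ (1 - β) * v / 2 := by
      rw [div_mul_eq_mul_div, div_le_div_iff₀ (by positivity) two_pos]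
      have := mul_le_mul_of_nonneg_left hvV (mul_nonneg hβ1.le hv0)
      nlinarith
    linarith
  · have h9 : min ((1 - β) / (2 * V)) (α * (1 - β) ^ 2 / (32 * ρ ^ 2)) * v ^ 2 ≤
        α * (1 - β) ^ 2 / (32 * ρ ^ 2) * v ^ 2 := by
      gcongr
      exact min_le_right _ _
    have h10 : ((1 - β) * v) ^ 2 ≤ (4 * ρ * x) ^ 2 := by
      gcongr
    have h11 : α * (1 - β) ^ 2 / (32 * ρ ^ 2) * v ^ 2 ≤ α / 2 * x ^ 2 := by
      rw [div_mul_eq_mul_div, div_le_iff₀ (by positivity)]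
      nlinarith
    linarith

/-- The cost of the first feasible reference point is bounded independently of the run. -/
lemma exists_initial_bound (D : SDP n m) (ρ α β : ℝ) (Ω₀ : Matrix (Fin n) (Fin n) ℝ)
    (hΩ₀ : Ω₀.IsSymm) (hrc : 1 ≤ rc) (hα : 0 < α) (hβ : 0 < β) (hρ : 0 < ρ)
    {Y : Matrix (Fin n) (Fin n) ℝ} (hY : Y ∈ D.affineSet) :
    ∃ M : ℝ, ∀ s : Iterates n m rp rc, IsRun D ρ α β Ω₀ s → D.F ρ (s.Ω 1) ≤ M := by
  by_cases hfeas : D.Amap Ω₀ = D.b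
  · refine ⟨D.F ρ Ω₀, fun s h => ?_⟩
    have h0 : s.Ω 0 ∈ D.affineSet := by
      rw [h.init_Ω]
      exact ⟨hΩ₀, hfeas⟩
    by_cases hacc : D.Accepts ρ β s 0
    · have h1 := h.descent_step hrc hα hβ hρ hΩ₀ h0 hacc
      have h2 := mul_nonneg hβ.le (h.predicted_nonneg hrc hα hρ hΩ₀ h0)
      rw [zero_add, h.init_Ω] at h1
      linarith
    · have h1 := h.step_null 0 hacc
      rw [zero_add] at h1
      rw [h1, h.init_Ω]
  · set T := 2 / α * (‖D.C‖ + ρ) + ‖Y - Ω₀‖ ^ 2 + 1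
    refine ⟨(‖D.C‖ + ρ) * (‖Y‖ + T), fun s h => ?_⟩
    have hacc : D.Accepts ρ β s 0 := Or.inl ⟨rfl, by rwa [h.init_Ω]⟩
    have h1 := h.step_accept 0 hacc
    rw [zero_add] at h1
    have h2 := (h.master hrc hα hρ hΩ₀ 0).norm_sub_le hα hρ.le hY
    rw [h.init_Ω] at h2
    obtain ⟨G, -, hG, hF⟩ := h.exists_exactWeight hrc hρ 0
    have h3 : ‖s.X 0‖ ≤ ‖Y‖ + T := by
      have : s.X 0 = Y - (Y - s.X 0) := by abel
      rw [this]
      exact (_root_.norm_sub_le _ _).trans (by linarith)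
    rw [h1, hF]
    have h4 := (abs_le.1 (abs_frobInner_le D.C (s.X 0))).2
    have h5 := (abs_le.1 (abs_frobInner_le G (s.X 0))).1
    have h6 : ‖G‖ * ‖s.X 0‖ ≤ ρ * ‖s.X 0‖ := by gcongr
    have h7 : (‖D.C‖ + ρ) * ‖s.X 0‖ ≤ (‖D.C‖ + ρ) * (‖Y‖ + T) := by gcongr
    linarith

end IsRun

end Run

/-! ### Iteration complexity -/

section Complexity

variable {n m : ℕ} {D : SDP n m} {ρ α β : ℝ}

lemma SDP.IsApproxSolution.mono {ε ε' : ℝ} (hε : ε ≤ ε') {Ω W : Matrix (Fin n) (Fin n) ℝ}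
    {y : Fin m → ℝ} (h : D.IsApproxSolution ρ ε Ω W y) : D.IsApproxSolution ρ ε' Ω W y := by
  obtain ⟨⟨X, hX, h1⟩, ⟨h2, h3⟩, ⟨h4, h5⟩, h6⟩ := h
  exact ⟨⟨X, hX, h1.trans hε⟩, ⟨h2, by linarith⟩, ⟨h4.trans hε, h5⟩,
    h6.trans (Real.sqrt_le_sqrt hε)⟩

/-- A small cost gap and a small predicted decrease give an approximate solution, with errors of
the orders `η`, `η`, `η` and `√η`. -/
lemma MasterSolution.isApproxSolution {r : ℕ} {Wbar Ω X W : Matrix (Fin n) (Fin n) ℝ}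
    {P : Matrix (Fin n) (Fin r) ℝ} {y : Fin m → ℝ} (h : MasterSolution D ρ α Wbar P Ω X W y)
    (hα : 0 < α) (hβ : 0 < β) (hρ : 0 < ρ) (hΩ : Ω ∈ D.affineSet)
    {Xs : Matrix (Fin n) (Fin n) ℝ} (hXs : Xs ∈ D.primalOptimal) {R η ε : ℝ} (hR : ‖Ω‖ ≤ R)
    (hμ : max (lamMax (-Ω)) 0 ≤ D.F ρ Ω - D.F ρ Xs) (hδ : D.F ρ Ω - D.F ρ Xs ≤ η)
    (hv : β * (D.F ρ Ω - D.masterObj ρ α Wbar P Ω X) ≤ η) (hη1 : η ≤ 1)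
    (hε : (1 + 2 * α / β + 4 * (α * R + ρ + ‖D.C‖) ^ 2 / (α * β) + 2 * ρ ^ 2) * η ≤ ε) :
    D.IsApproxSolution ρ ε Ω W y := by
  have hμ0 := le_max_right (lamMax (-Ω)) 0
  have hη0 : 0 ≤ η := by linarith
  set L := α * R + ρ + ‖D.C‖ with hL
  have hR0 : 0 ≤ R := (norm_nonneg _).trans hR
  have hL0 : 0 ≤ L := by positivity
  have h1 : 0 ≤ 2 * α / β * η := by positivity
  have h2 : 0 ≤ 4 * L ^ 2 / (α * β) * η := by positivity
  have h3 : 0 ≤ 2 * ρ ^ 2 * η := by positivity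
  have hηε : η ≤ ε := by linarith
  have hd : ‖X - Ω‖ ^ 2 ≤ 2 / (α * β) * η := by
    have h4 := mul_le_mul_of_nonneg_left (h.step_sq_le hΩ) hβ.le
    rw [div_mul_eq_mul_div, le_div_iff₀ (by positivity)]
    linarith
  refine ⟨⟨Xs, hXs, hδ.trans hηε⟩, ⟨hΩ.2, ?_⟩, ⟨?_, h.adm.posSemidef h.W_mem⟩, ?_⟩
  · rw [lamMin_eq_neg_lamMax_neg]
    linarith [le_max_left (lamMax (-Ω)) 0]
  · have h4 : W + D.Aadj y - D.C = α • (X - Ω) := by rw [h.grad]; abel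
    rw [h4, ← norm_sq_eq_frobSq, norm_smul, mul_pow, Real.norm_of_nonneg hα.le]
    calc α ^ 2 * ‖X - Ω‖ ^ 2 ≤ α ^ 2 * (2 / (α * β) * η) := by gcongr
      _ = 2 * α / β * η := by field_simp
      _ ≤ ε := by linarith
  · refine (h.abs_gap_le hα hρ hΩ).trans (Real.le_sqrt_of_sq_le ?_)
    have h4 : (α * ‖Ω‖ + ρ + ‖D.C‖) * ‖X - Ω‖ + ρ * max (lamMax (-Ω)) 0 ≤ L * ‖X - Ω‖ + ρ * η := by
      rw [hL]
      gcongr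
      exact hμ.trans hδ
    have h5 : 0 ≤ (α * ‖Ω‖ + ρ + ‖D.C‖) * ‖X - Ω‖ + ρ * max (lamMax (-Ω)) 0 := by positivity
    have h6 : η ^ 2 ≤ η := by nlinarith
    calc ((α * ‖Ω‖ + ρ + ‖D.C‖) * ‖X - Ω‖ + ρ * max (lamMax (-Ω)) 0) ^ 2
        ≤ (L * ‖X - Ω‖ + ρ * η) ^ 2 := by gcongr
      _ ≤ 2 * L ^ 2 * ‖X - Ω‖ ^ 2 + 2 * ρ ^ 2 * η ^ 2 := by
          nlinarith [sq_nonneg (L * ‖X - Ω‖ - ρ * η)]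
      _ ≤ 2 * L ^ 2 * (2 / (α * β) * η) + 2 * ρ ^ 2 * η := by gcongr
      _ = 4 * L ^ 2 / (α * β) * η + 2 * ρ ^ 2 * η := by ring
      _ ≤ ε := by linarith

/-- The complexity bound common to both regimes. The hypothesis on `w` says that, when the cost gap
exceeds the tolerance, moving from `Ω` along the segment to a suitable optimal solution `Y`
predicts a decrease of at least `w` times the cost gap; the bound is then `O(1 / (ε w²))`. -/
lemma exists_iteration_isApproxSolution (hlin : LinearIndependent ℝ D.A) (hs : D.Slater)
    {rp rc : ℕ} (hrc : 1 ≤ rc) (hα : 0 < α) (hβ : β ∈ Set.Ioo (0 : ℝ) 1) {p : ℝ}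
    (hρ : ∀ q ∈ D.dualOptimal, q.2.trace + 1 ≤ ρ) (hp : ∀ q ∈ D.dualOptimal, D.b ⬝ᵥ q.1 = p)
    {Ω₀ : Matrix (Fin n) (Fin n) ℝ} (hΩ₀ : Ω₀.IsSymm) :
    ∃ K N M : ℝ, 0 ≤ K ∧ 1 ≤ N ∧ 1 ≤ M ∧ ∀ ε w : ℝ, 0 < ε → ε ≤ 1 → 0 < w → w ≤ 1 →
      (∀ Ω ∈ D.affineSet, ε / N < D.F ρ Ω - p → D.F ρ Ω - p ≤ M →
        ∃ Y ∈ D.primalOptimal, ∃ σ : ℝ, 0 ≤ σ ∧ σ ≤ 1 ∧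
          w * (D.F ρ Ω - p) ≤ σ * (D.F ρ Ω - p) - α / 2 * σ ^ 2 * ‖Ω - Y‖ ^ 2) →
      ∀ s : Iterates n m rp rc, IsRun D ρ α β Ω₀ s →
        ∃ t : ℕ, (t : ℝ) ≤ K / (ε * w ^ 2) ∧
          D.IsApproxSolution ρ ε (s.Ω t) (s.W t) (s.y t) := by
  obtain ⟨Xs, hXs, q, hq, hXq⟩ := SDP.exists_optimal_pair hlin hs
  have hρ0 : 0 < ρ := by linarith [hρ q hq, hq.1.2.trace_nonneg]
  have hFopt : ∀ Y ∈ D.primalOptimal, D.F ρ Y = p := fun Y hY => by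
    rw [SDP.F_eq_of_posSemidef ρ hY.1.1, SDP.optimal_value_eq hlin hs hY hq, hp q hq]
  have haff : ∀ Y ∈ D.primalOptimal, Y ∈ D.affineSet := fun Y hY => ⟨hY.1.1.isSymm', hY.1.2⟩
  have hμ : ∀ Ω ∈ D.affineSet, max (lamMax (-Ω)) 0 ≤ D.F ρ Ω - p := fun Ω hΩ => by
    rw [← hp q hq]
    exact SDP.max_lamMax_le_F_sub hq.1 (hρ q hq) hΩ
  obtain ⟨M₀, hM₀⟩ := IsRun.exists_initial_bound (rp := rp) D ρ α β Ω₀ hΩ₀ hrc hα hβ.1 hρ0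
    (haff Xs hXs)
  set M := max 1 (M₀ - p) with hM
  have hM1 : 1 ≤ M := le_max_left _ _
  obtain ⟨R, hR0, hR⟩ := SDP.exists_bound_of_F_le hs hq.1 (hρ q hq) M
  rw [hp q hq] at hR
  set V := ρ * M + ‖D.C‖ ^ 2 / (2 * α) with hV
  have hV0 : 0 < V := by positivity
  have hβ1 : 0 < 1 - β := sub_pos.2 hβ.2
  set c := min ((1 - β) / (2 * V)) (α * (1 - β) ^ 2 / (32 * ρ ^ 2)) with hc
  have hc0 : 0 < c := by
    rw [hc, lt_min_iff]
    constructor <;> positivity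
  obtain ⟨K, hK0, hK⟩ := exists_iteration_le hβ.1 hc0 (zero_le_one.trans hM1)
  set N := 1 + 2 * α / β + 4 * (α * R + ρ + ‖D.C‖) ^ 2 / (α * β) + 2 * ρ ^ 2 with hN
  have hβ0 := hβ.1
  have hN1 : 1 ≤ N := by
    have h1 : 0 ≤ 2 * α / β := by positivity
    have h2 : 0 ≤ 4 * (α * R + ρ + ‖D.C‖) ^ 2 / (α * β) := by positivity
    have h3 : 0 ≤ 2 * ρ ^ 2 := by positivity
    linarith
  refine ⟨K * N + 1, N, M, by positivity, hN1, hM1, fun ε w hε hε1 hw hw1 hgrow s hrun => ?_⟩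
  have hmem := hrun.Ω_succ_mem hΩ₀
  have hstep : ∀ t, (D.F ρ (s.Ω (t + 1 + 1)) - p = D.F ρ (s.Ω (t + 1)) - p ∧
      ¬ D.Accepts ρ β s (t + 1)) ∨
      D.F ρ (s.Ω (t + 1 + 1)) - p ≤ D.F ρ (s.Ω (t + 1)) - p - β * s.predicted D ρ α (t + 1) := by
    intro t
    by_cases hacc : D.Accepts ρ β s (t + 1)
    · right
      linarith [hrun.descent_step hrc hα hβ0 hρ0 hΩ₀ (hmem t) hacc]
    · left
      exact ⟨by rw [hrun.step_null _ hacc], hacc⟩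
  have hv0 : ∀ t, 0 ≤ s.predicted D ρ α (t + 1) := fun t =>
    hrun.predicted_nonneg hrc hα hρ0 hΩ₀ (hmem t)
  have hδM : ∀ t, D.F ρ (s.Ω (t + 1)) - p ≤ M := by
    intro t
    induction t with
    | zero =>
      have := hM₀ s hrun
      rw [hM, zero_add]
      exact le_max_of_le_right (by linarith)
    | succ t ih =>
      rcases hstep t with ⟨h1, -⟩ | h1
      · rwa [h1]
      · linarith [mul_nonneg hβ0.le (hv0 t)]
  have hvV : ∀ t, s.predicted D ρ α (t + 1) ≤ V := fun t => by
    refine ((hrun.master hrc hα hρ0 hΩ₀ (t + 1)).predicted_le hα).trans ?_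
    rw [hV]
    gcongr
    exact (hμ _ (hmem t)).trans (hδM t)
  obtain ⟨t, ht, hδt, hvt⟩ := hK (fun t => D.F ρ (s.Ω (t + 1)) - p)
    (fun t => s.predicted D ρ α (t + 1))
    (fun t => (le_max_right _ _).trans (hμ _ (hmem t))) hδM hv0
    (fun t => (hstep t).imp (fun h1 => ⟨h1.1,
      hrun.null_step hrc hα hβ hρ0 hΩ₀ hV0 (hmem t) (hvV t) h1.2⟩) id)
    (ε / N) w (by positivity) (by rw [div_le_one (by positivity)]; linarith) hw hw1
    (fun t ht => by
      obtain ⟨Y, hY, σ, hσ0, hσ1, h1⟩ := hgrow _ (hmem t) ht (hδM t)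
      refine h1.trans ?_
      rw [← hFopt Y hY]
      exact (hrun.master hrc hα hρ0 hΩ₀ (t + 1)).le_predicted hα (hmem t) (haff Y hY) hσ0 hσ1)
  refine ⟨t + 1, ?_, ?_⟩
  · have h1 : 1 ≤ 1 / (ε * w ^ 2) := by
      rw [le_div_iff₀ (by positivity), one_mul]
      exact mul_le_one₀ hε1 (by positivity) (pow_le_one₀ hw.le hw1)
    push_cast
    calc (t : ℝ) + 1 ≤ K / (ε / N * w ^ 2) + 1 / (ε * w ^ 2) := add_le_add ht h1
      _ = (K * N + 1) / (ε * w ^ 2) := by field_simp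
  · refine (hrun.master hrc hα hρ0 hΩ₀ (t + 1)).isApproxSolution hα hβ0 hρ0 (hmem t) hXs
      (hR _ (hmem t) (hδM t)).1 ?_ (η := ε / N) ?_ hvt ?_ ?_
    · rw [hFopt Xs hXs]
      exact hμ _ (hmem t)
    · rw [hFopt Xs hXs]
      exact hδt
    · rw [div_le_one (by positivity)]
      linarith
    · rw [mul_div_cancel₀ _ (by positivity)]

/-- Passing from tolerances at most one to arbitrary tolerances. -/
lemma exists_bound_max {rp rc : ℕ} {Ω₀ : Matrix (Fin n) (Fin n) ℝ} {K : ℝ} (hK : 0 ≤ K) (k : ℕ)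
    (h : ∀ ε : ℝ, 0 < ε → ε ≤ 1 → ∀ s : Iterates n m rp rc, IsRun D ρ α β Ω₀ s →
      ∃ t : ℕ, (t : ℝ) ≤ K * (1 / ε ^ k) ∧ D.IsApproxSolution ρ ε (s.Ω t) (s.W t) (s.y t)) :
    ∃ K : ℝ, ∀ s : Iterates n m rp rc, IsRun D ρ α β Ω₀ s → ∀ ε : ℝ, 0 < ε →
      ∃ t : ℕ, (t : ℝ) ≤ K * max 1 (1 / ε ^ k) ∧
        D.IsApproxSolution ρ ε (s.Ω t) (s.W t) (s.y t) := by
  refine ⟨K, fun s hrun ε hε => ?_⟩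
  rcases le_total ε 1 with h1 | h1
  · obtain ⟨t, ht, hst⟩ := h ε hε h1 s hrun
    exact ⟨t, ht.trans (by gcongr; exact le_max_right _ _), hst⟩
  · obtain ⟨t, ht, hst⟩ := h 1 one_pos le_rfl s hrun
    exact ⟨t, ht.trans (by gcongr; simp), hst.mono h1⟩

end Complexity

end SBMP

theorem mainTheorem1 {n m : ℕ} (D : SBMP.SDP n m)
    (hlin : LinearIndependent ℝ D.A) (hslater : D.Slater)
    (rp rc : ℕ) (hrc : 1 ≤ rc) (α β ρ : ℝ) (hα : 0 < α) (hβ : β ∈ Set.Ioo (0 : ℝ) 1)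
    (hρ : 2 * D.maxDualTrace + 1 < ρ)
    (Ω₀ : Matrix (Fin n) (Fin n) ℝ) (hΩ₀ : Ω₀.IsSymm) :
    (∃ K : ℝ, ∀ s : SBMP.Iterates n m rp rc, SBMP.IsRun D ρ α β Ω₀ s → ∀ ε : ℝ, 0 < ε →
      ∃ t : ℕ, (t : ℝ) ≤ K * max 1 (1 / ε ^ 3) ∧
        D.IsApproxSolution ρ ε (s.Ω t) (s.W t) (s.y t)) ∧
    (D.StrictComplementarity →
      ∃ K : ℝ, ∀ s : SBMP.Iterates n m rp rc, SBMP.IsRun D ρ α β Ω₀ s → ∀ ε : ℝ, 0 < ε →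
        ∃ t : ℕ, (t : ℝ) ≤ K * max 1 (1 / ε) ∧
          D.IsApproxSolution ρ ε (s.Ω t) (s.W t) (s.y t)) := by
  open scoped Matrix.Norms.Frobenius in
  obtain ⟨Xs, hXs, q, hq, hXq⟩ := SBMP.SDP.exists_optimal_pair hlin hslater
  set p := D.b ⬝ᵥ q.1 with hpdef
  have hρ' : ∀ q' ∈ D.dualOptimal, q'.2.trace + 1 ≤ ρ := fun q' hq' => by
    linarith [SBMP.SDP.trace_le_maxDualTrace hslater hq', D.maxDualTrace_nonneg]
  have hp : ∀ q' ∈ D.dualOptimal, D.b ⬝ᵥ q'.1 = p := fun q' hq' => by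
    rw [← SBMP.SDP.optimal_value_eq hlin hslater hXs hq', hXq]
  have hFs : D.F ρ Xs = p := by rw [SBMP.SDP.F_eq_of_posSemidef ρ hXs.1.1, hXq]
  obtain ⟨K, N, M, hK, hN, hM, hmain⟩ := SBMP.exists_iteration_isApproxSolution (rp := rp) hlin
    hslater hrc hα hβ hρ' hp hΩ₀
  have hN0 : 0 < N := by linarith
  constructor
  · -- On a bounded set the predicted decrease is at least a multiple of the squared cost gap `δ`:
    -- `σ = δ / B ≤ 1` makes the quadratic term at most half of the linear one.
    obtain ⟨R, hR0, hR⟩ := SBMP.SDP.exists_bound_of_F_le hslater hq.1 (hρ' q hq) M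
    rw [← hpdef] at hR
    set B := α * (2 * R) ^ 2 + M with hB
    have hB1 : 1 ≤ B := by
      have : 0 ≤ α * (2 * R) ^ 2 := by positivity
      linarith
    refine SBMP.exists_bound_max (K := K * (2 * B * N) ^ 2) (by positivity) 3
      fun ε hε hε1 s hrun => ?_
    have hεN : ε ≤ 2 * B * N := by nlinarith
    have hseg : ∀ Ω ∈ D.affineSet, ε / N < D.F ρ Ω - p → D.F ρ Ω - p ≤ M →
        ∃ Y ∈ D.primalOptimal, ∃ σ : ℝ, 0 ≤ σ ∧ σ ≤ 1 ∧
          ε / (2 * B * N) * (D.F ρ Ω - p) ≤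
            σ * (D.F ρ Ω - p) - α / 2 * σ ^ 2 * ‖Ω - Y‖ ^ 2 := by
      intro Ω hΩ hlt hle
      set δ := D.F ρ Ω - p
      have hδ0 : 0 < δ := lt_trans (by positivity) hlt
      refine ⟨Xs, hXs, δ / B, by positivity, ?_, ?_⟩
      · rw [div_le_one (by positivity)]
        have : 0 ≤ α * (2 * R) ^ 2 := by positivity
        linarith
      · have h1 : ‖Ω - Xs‖ ^ 2 ≤ (2 * R) ^ 2 := by
          have h2 := (hR Ω hΩ hle).1
          have h3 := (hR Xs ⟨hXs.1.1.isSymm', hXs.1.2⟩ (by rw [hFs]; linarith)).1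
          gcongr
          exact (norm_sub_le _ _).trans (by linarith)
        have h4 : ε / (2 * B * N) * δ ≤ δ / B * δ / 2 := by
          have : ε / (2 * B * N) * δ = ε / N * δ / B / 2 := by field_simp
          rw [this]
          calc ε / N * δ / B / 2 ≤ δ * δ / B / 2 := by gcongr
            _ = _ := by ring
        have h5 : α / 2 * (δ / B) ^ 2 * ‖Ω - Xs‖ ^ 2 ≤ δ / B * δ / 2 := by
          have h6 : α * ‖Ω - Xs‖ ^ 2 ≤ B := by
            have := mul_le_mul_of_nonneg_left h1 hα.le
            linarith
          calc _ = (δ / B) ^ 2 / 2 * (α * ‖Ω - Xs‖ ^ 2) := by ring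
            _ ≤ (δ / B) ^ 2 / 2 * B := by gcongr
            _ = _ := by field_simp
        linarith
    obtain ⟨t, ht, hst⟩ := hmain ε (ε / (2 * B * N)) hε hε1 (by positivity)
      (by rwa [div_le_one (by positivity)]) hseg s hrun
    refine ⟨t, ht.trans (le_of_eq ?_), hst⟩
    field_simp
  · intro hsc
    obtain ⟨κ, hκ, hgrow⟩ := SBMP.SDP.exists_quadratic_growth hlin hslater hsc hρ' hp M
    -- Quadratic growth makes the quadratic term at most half of the linear one for a constant `σ`.
    set B := α * κ + 1 with hB
    have hB1 : 1 ≤ B := by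
      have : 0 ≤ α * κ := by positivity
      linarith
    have hseg : ∀ Ω ∈ D.affineSet, 0 < D.F ρ Ω - p → D.F ρ Ω - p ≤ M →
        ∃ Y ∈ D.primalOptimal, ∃ σ : ℝ, 0 ≤ σ ∧ σ ≤ 1 ∧
          1 / (2 * B) * (D.F ρ Ω - p) ≤
            σ * (D.F ρ Ω - p) - α / 2 * σ ^ 2 * ‖Ω - Y‖ ^ 2 := by
      intro Ω hΩ hδ0 hle
      obtain ⟨Y, hY, hΩY⟩ := hgrow Ω hΩ hle
      set δ := D.F ρ Ω - p
      refine ⟨Y, hY, 1 / B, by positivity, by rwa [div_le_one (by positivity)], ?_⟩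
      have h1 : α / 2 * (1 / B) ^ 2 * ‖Ω - Y‖ ^ 2 ≤ 1 / B * δ / 2 := by
        calc _ ≤ α / 2 * (1 / B) ^ 2 * (κ * δ) := by gcongr
          _ = (1 / B) ^ 2 * δ / 2 * (α * κ) := by ring
          _ ≤ (1 / B) ^ 2 * δ / 2 * B := by gcongr; linarith
          _ = _ := by field_simp
      have h2 : 1 / (2 * B) * δ = 1 / B * δ / 2 := by field_simp
      linarith
    have key := SBMP.exists_bound_max (D := D) (ρ := ρ) (α := α) (β := β) (rp := rp) (rc := rc)
      (Ω₀ := Ω₀) (K := K * (2 * B) ^ 2) (by positivity) 1 fun ε hε hε1 s hrun => by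
        obtain ⟨t, ht, hst⟩ := hmain ε (1 / (2 * B)) hε hε1 (by positivity)
          (by rw [div_le_one (by positivity)]; linarith)
          (fun Ω hΩ hlt hle => hseg Ω hΩ (lt_trans (by positivity) hlt) hle) s hrun
        refine ⟨t, ht.trans (le_of_eq ?_), hst⟩
        field_simp
    simpa only [pow_one] using key
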